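/- Setting. Let $H$ be a real inner product space with inner product $\langle\cdot,\cdot\rangle$ (for instance $H=L^2(\mathbb R^N;\mathbb R^K)$), let $V$ be a Banach space continuously embedded in $H$ (the energy space of $M$), and let $M:V\to V^*$ be a topological isomorphism that is Hermitian, $(Mv)(w)=(Mw)(v)$, and positive definite, $(Mv)(v)>0$ for $v\neq0$. An element $v\in V$ is identified with the functional $\langle v,\cdot\rangle\in V^*$. Let $L_{00}:V\to V^*$ be a nonlinear operator. For $\mu\in\mathbb R$ put $L_0u=L_{00}u-\mu u$, let $L_1=DL_{00}(u)-\mu:V\to V^*$ be the linearization of $L_0$ at $u$, let $L_1^\dagger$ be its adjoint, $(L_1^\dagger v)(w)=(L_1w)(v)$, and let $\langle u,u\rangle$ be the power of $u$. The power-conserving squared-operator method (PCSOM) with time step $\Delta t$ and prescribed power $P$ is $$u_{n+1}=\Big[\frac{P}{\langle\hat u_{n+1},\hat u_{n+1}\rangle}\Big]^{1/2}\hat u_{n+1},\qquad \hat u_{n+1}=u_n-M^{-1}\big[L_1^\dagger M^{-1}L_0u-\gamma u\big]_{u=u_n,\ \mu=\mu_n}\,\Delta t,$$ $$\gamma=\frac{\langle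 u,M^{-1}L_1^\dagger M^{-1}L_0u\rangle}{\langle u,M^{-1}u\rangle},\qquad \mu_n=\frac{\langle u,M^{-1}L_{00}u\rangle}{\langle u,M^{-1}u\rangle}\Big|_{u=u_n}.$$ Theorem. Let $u(\mu',c)\in V$, with $c=(c_1,\dots,c_s)$ ($s\ge0$), be a family of solutions of $L_{00}v=\mu'v$ that is defined and continuously differentiable for $(\mu',c)$ near $(\mu,c^0)$, let $u=u(\mu,c^0)$, and let $L_{00}$ be differentiable with Lipschitz continuous derivative near $u$. Assume that 1. the kernel of $L_1$ (at $u$, $\mu$) is spanned by the invariance modes $\partial u/\partial c_j$, $1\le j\le s$, at $(\mu,c^0)$; 2. $u$ is orthogonal to the kernel of $L_1$; 3. $P'(\mu)\ne0$, where $P(\mu')=\langle u(\mu',c^0),u(\mu',c^0)\rangle$. Let $P=\langle u,u\rangle$, let $S=\{\Psi\in V:\langle\Psi,u\rangle=0\}$, and let $\mathcal L_{PC}:S\to S$ be $$\mathcal L_{PC}\Psi=M^{-1}(\hat L\Psi-\hat\gamma u),\qquad \hat L\Psi=-L_1^\dagger M^{-1}(L_1\Psi-\beta u),$$ $$\hat\gamma=\frac{\langle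 u,M^{-1}\hat L\Psi\rangle}{\langle u,M^{-1}u\rangle},\qquad \beta=\frac{\langle u,M^{-1}L_1\Psi\rangle}{\langle u,M^{-1}u\rangle}.$$ Let $\Lambda_{\min}$ be the minimum of the spectrum of $\mathcal L_{PC}$, assume that $\Lambda_{\min}\ne0$, and put $\Delta t_{\max}=-2/\Lambda_{\min}$. (a) Let zero not be in the continuous spectrum of $L_1$, that is, let the range of $L_1$ be closed in $V^*$. If $0<\Delta t<\Delta t_{\max}$, then the PCSOM with power $P$ converges to the solitary wave $u$, up to a small shift of the constants of the family, for all initial conditions close to $u$: for every $\varepsilon>0$ there is a $\delta>0$ such that, whenever $\|u_0-u\|_V<\delta$, all iterates satisfy $\|u_n-u\|_V<\varepsilon$, and there are constants $(\mu',c')$ with $|\mu'-\mu|<\varepsilon$, $\|c'-c^0\|<\varepsilon$ such that $u(\mu',c')$ solves $L_{00}v=\mu'v$ and has power $P$, $u_n\to u(\mu',c')$ in $V$ and $\mu_n\to\mu'$. (b) If $\Delta t>\Delta t_{\max}$, then the PCSOM with power $P$ diverges from $u$: there is an $\varepsilon>0$ such that arbitrarily close to $u$ there are initial conditions of power $P$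 for which $\|u_n-u\|_V\ge\varepsilon$ for some $n$. If moreover the interval $[\Lambda_{\min},-2/\Delta t]$ is not entirely contained in the spectrum of $\mathcal L_{PC}$ (in particular, if $\Lambda_{\min}$ is an isolated eigenvalue), then the divergence is generic: for some $\varepsilon>0$, the initial conditions of power $P$ for which $\|u_n-u\|_V\ge\varepsilon$ for some $n$ are dense among the functions $v$ of power $P$ with $\|v-u\|_V<\varepsilon$. -/

import Mathlib

open Filter Topology

noncomputable section

/-- An acceleration operator: a real, positive-definite, Hermitian operator `M`, acting as an
isomorphism from its energy space `V` onto the dual of `V`. The value `op v w` is the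
pairing of `M v` with `w`. -/
structure AccelerationOperator (V : Type*) [NormedAddCommGroup V] [NormedSpace ℝ V] where
  op : V ≃L[ℝ] StrongDual ℝ V
  hermitian : ∀ v w : V, op v w = op w v
  posDef : ∀ v : V, v ≠ 0 → 0 < op v v

namespace PCSOM

section Definitions

variable {V H : Type*} [NormedAddCommGroup V] [NormedSpace ℝ V]
  [NormedAddCommGroup H] [InnerProductSpace ℝ H]

/-- The inner product `⟨v, w⟩` of `H` (the `L²` inner product when `H` is `L²`), for
elements of `V`; `ι` is the inclusion of `V` in `H`. -/
def ip (ι : V →L[ℝ] H) (v w : V) : ℝ := inner ℝ (ι v) (ι w)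

/-- The power `⟨v, v⟩`. -/
def power (ι : V →L[ℝ] H) (v : V) : ℝ := ip ι v v

/-- The element `v` of `V` regarded as an element `⟨v, ·⟩` of the dual of `V`. -/
def embed (ι : V →L[ℝ] H) : V →L[ℝ] StrongDual ℝ V := (innerSL ℝ).bilinearComp ι ι

theorem embed_apply (ι : V →L[ℝ] H) (v w : V) : embed ι v w = ip ι v w := rfl

/-- `M⁻¹`. -/
def Minv (M : AccelerationOperator V) : StrongDual ℝ V →L[ℝ] V := M.op.symm

/-- `⟨u, M⁻¹ u⟩`. -/
def denom (ι : V →L[ℝ] H) (M : AccelerationOperator V) (u : V) : ℝ :=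
  ip ι u (Minv M (embed ι u))

/-- `L₀ u = L₀₀ u - μ u`. -/
def L0 (ι : V →L[ℝ] H) (L00 : V → StrongDual ℝ V) (μ : ℝ) (u : V) : StrongDual ℝ V :=
  L00 u - μ • embed ι u

/-- `L₁`, the linearization of `L₀` (with `μ` fixed) at `u`. -/
def L1 (ι : V →L[ℝ] H) (L00 : V → StrongDual ℝ V) (μ : ℝ) (u : V) :
    V →L[ℝ] StrongDual ℝ V :=
  fderiv ℝ L00 u - μ • embed ι

/-- The adjoint `L₁†`: the pairing of `L₁† v` with `w` is the pairing of `L₁ w` with `v`. -/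
def L1adj (ι : V →L[ℝ] H) (L00 : V → StrongDual ℝ V) (μ : ℝ) (u : V) :
    V →L[ℝ] StrongDual ℝ V :=
  (L1 ι L00 μ u).flip

/-! ### The iteration -/

/-- The Rayleigh quotient `⟨u, M⁻¹ L₀₀ u⟩ / ⟨u, M⁻¹ u⟩` that gives `μₙ` from `u = uₙ`. -/
def rayleigh (ι : V →L[ℝ] H) (M : AccelerationOperator V) (L00 : V → StrongDual ℝ V)
    (u : V) : ℝ :=
  ip ι u (Minv M (L00 u)) / denom ι M u

/-- `L₁† M⁻¹ L₀ u`, with `L₀` and `L₁` taken at `u` and at the given `μ`. -/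
def squaredTerm (ι : V →L[ℝ] H) (M : AccelerationOperator V) (L00 : V → StrongDual ℝ V)
    (μ : ℝ) (u : V) : StrongDual ℝ V :=
  L1adj ι L00 μ u (Minv M (L0 ι L00 μ u))

/-- `γ = ⟨u, M⁻¹ L₁† M⁻¹ L₀ u⟩ / ⟨u, M⁻¹ u⟩`. -/
def gam (ι : V →L[ℝ] H) (M : AccelerationOperator V) (L00 : V → StrongDual ℝ V)
    (μ : ℝ) (u : V) : ℝ :=
  ip ι u (Minv M (squaredTerm ι M L00 μ u)) / denom ι M u

/-- The predictor `û = u - M⁻¹ [L₁† M⁻¹ L₀ u - γ u] Δt`, evaluated at `μ = μₙ`. -/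
def predictor (ι : V →L[ℝ] H) (M : AccelerationOperator V) (L00 : V → StrongDual ℝ V)
    (Δt : ℝ) (u : V) : V :=
  u - Δt • Minv M (squaredTerm ι M L00 (rayleigh ι M L00 u) u
    - gam ι M L00 (rayleigh ι M L00 u) u • embed ι u)

/-- One step of the method: `[P / ⟨û, û⟩]^(1/2) û`. -/
def step (ι : V →L[ℝ] H) (M : AccelerationOperator V) (L00 : V → StrongDual ℝ V)
    (P Δt : ℝ) (u : V) : V :=
  √(P / power ι (predictor ι M L00 Δt u)) • predictor ι M L00 Δt u

/-- The iterates `uₙ` started at `u₀`. -/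
def iterates (ι : V →L[ℝ] H) (M : AccelerationOperator V) (L00 : V → StrongDual ℝ V)
    (P Δt : ℝ) (u₀ : V) (n : ℕ) : V :=
  (step ι M L00 P Δt)^[n] u₀

/-! ### The linearized iteration operator -/

/-- `β`, as a functional of `Ψ`: `⟨u, M⁻¹ L₁ Ψ⟩ / ⟨u, M⁻¹ u⟩`. -/
def beta (ι : V →L[ℝ] H) (M : AccelerationOperator V) (L00 : V → StrongDual ℝ V)
    (μ : ℝ) (u : V) : StrongDual ℝ V :=
  (denom ι M u)⁻¹ • (embed ι u ∘L Minv M ∘L L1 ι L00 μ u)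

/-- `L̂ Ψ = -L₁† M⁻¹ (L₁ Ψ - β u)`. -/
def Lhat (ι : V →L[ℝ] H) (M : AccelerationOperator V) (L00 : V → StrongDual ℝ V)
    (μ : ℝ) (u : V) : V →L[ℝ] StrongDual ℝ V :=
  -(L1adj ι L00 μ u ∘L Minv M ∘L
    (L1 ι L00 μ u - (beta ι M L00 μ u).smulRight (embed ι u)))

/-- `γ̂`, as a functional of `Ψ`: `⟨u, M⁻¹ L̂ Ψ⟩ / ⟨u, M⁻¹ u⟩`. -/
def gammaHat (ι : V →L[ℝ] H) (M : AccelerationOperator V) (L00 : V → StrongDual ℝ V)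
    (μ : ℝ) (u : V) : StrongDual ℝ V :=
  (denom ι M u)⁻¹ • (embed ι u ∘L Minv M ∘L Lhat ι M L00 μ u)

/-- `𝓛_PC Ψ = M⁻¹ (L̂ Ψ - γ̂ u)`, on all of `V`. -/
def LPCfull (ι : V →L[ℝ] H) (M : AccelerationOperator V) (L00 : V → StrongDual ℝ V)
    (μ : ℝ) (u : V) : V →L[ℝ] V :=
  Minv M ∘L (Lhat ι M L00 μ u - (gammaHat ι M L00 μ u).smulRight (embed ι u))

/-- The space `S = {Ψ : ⟨Ψ, u⟩ = 0}`. -/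
def orthSpace (ι : V →L[ℝ] H) (u : V) : Submodule ℝ V :=
  LinearMap.ker (embed ι u : V →ₗ[ℝ] ℝ)

theorem mem_orthSpace (ι : V →L[ℝ] H) (u Ψ : V) :
    Ψ ∈ orthSpace ι u ↔ ip ι Ψ u = 0 := by
  simp only [orthSpace, LinearMap.mem_ker, ContinuousLinearMap.coe_coe, embed_apply]
  rw [ip, ip, real_inner_comm]

theorem denom_ne_zero (ι : V →L[ℝ] H) (M : AccelerationOperator V) (u : V)
    (hu : embed ι u ≠ 0) : denom ι M u ≠ 0 := by
  have h1 : Minv M (embed ι u) ≠ 0 := by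
    intro h
    exact hu (M.op.symm.map_eq_zero_iff.mp h)
  have h2 := M.posDef _ h1
  have h3 : M.op (Minv M (embed ι u)) = embed ι u := M.op.apply_symm_apply _
  rw [h3] at h2
  exact h2.ne'

theorem LPCfull_mem (ι : V →L[ℝ] H) (M : AccelerationOperator V) (L00 : V → StrongDual ℝ V)
    (μ : ℝ) (u Ψ : V) : LPCfull ι M L00 μ u Ψ ∈ orthSpace ι u := by
  by_cases hu : embed ι u = 0
  · simp [orthSpace, hu]
  · have hd := denom_ne_zero ι M u hu
    have hd' : embed ι u (Minv M (embed ι u)) = denom ι M u := rfl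
    simp only [orthSpace, LinearMap.mem_ker, ContinuousLinearMap.coe_coe, LPCfull, gammaHat,
      ContinuousLinearMap.comp_apply, _root_.sub_apply,
      ContinuousLinearMap.smulRight_apply, _root_.smul_apply, map_sub, map_smul,
      smul_eq_mul, hd']
    field_simp
    ring

/-- The iteration operator `𝓛_PC` on the space `S`. -/
def LPC (ι : V →L[ℝ] H) (M : AccelerationOperator V) (L00 : V → StrongDual ℝ V)
    (μ : ℝ) (u : V) : orthSpace ι u →L[ℝ] orthSpace ι u :=
  ((LPCfull ι M L00 μ u).comp (orthSpace ι u).subtypeL).codRestrict (orthSpace ι u)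
    (fun Ψ => LPCfull_mem ι M L00 μ u Ψ)

/-! ### Solution families and the two asymptotic behaviours -/

/-- `U μ' c` is, for `(μ', c)` near `(μ, c₀)`, a continuously differentiable family of
solutions of `L₀₀ v = μ' v`, with free real parameters `c = (c₁, …, c_s)`. -/
def IsSolutionFamily (ι : V →L[ℝ] H) (L00 : V → StrongDual ℝ V) {s : ℕ}
    (U : ℝ → (Fin s → ℝ) → V) (μ : ℝ) (c₀ : Fin s → ℝ) : Prop :=
  ContDiffAt ℝ 1 (fun p : ℝ × (Fin s → ℝ) => U p.1 p.2) (μ, c₀) ∧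
    ∀ᶠ p : ℝ × (Fin s → ℝ) in 𝓝 (μ, c₀), L0 ι L00 p.1 (U p.1 p.2) = 0

/-- The invariance mode `∂U/∂c_j` at `(μ, c₀)`. -/
def invarianceMode {s : ℕ} (U : ℝ → (Fin s → ℝ) → V) (μ : ℝ) (c₀ : Fin s → ℝ)
    (j : Fin s) : V :=
  lineDeriv ℝ (U μ) c₀ (Pi.single j 1)

/-- The method with time step `Δt` and power `P` converges for initial conditions close to
the solitary wave `U μ c₀`: if `u₀` is close enough to it, then all iterates stay close, and
they converge to a solitary wave of power `P` whose constants `(μ', c')` are as close to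
`(μ, c₀)` as desired; the `μₙ` converge to its propagation constant. -/
def ConvergesNear (ι : V →L[ℝ] H) (M : AccelerationOperator V) (L00 : V → StrongDual ℝ V)
    {s : ℕ} (U : ℝ → (Fin s → ℝ) → V) (μ : ℝ) (c₀ : Fin s → ℝ) (P Δt : ℝ) : Prop :=
  ∀ ε > 0, ∃ δ > 0, ∀ u₀ : V, ‖u₀ - U μ c₀‖ < δ →
    (∀ n, ‖iterates ι M L00 P Δt u₀ n - U μ c₀‖ < ε) ∧
    ∃ (μ' : ℝ) (c' : Fin s → ℝ), |μ' - μ| < ε ∧ ‖c' - c₀‖ < ε ∧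
      L0 ι L00 μ' (U μ' c') = 0 ∧ power ι (U μ' c') = P ∧
      Tendsto (iterates ι M L00 P Δt u₀) atTop (𝓝 (U μ' c')) ∧
      Tendsto (fun n => rayleigh ι M L00 (iterates ι M L00 P Δt u₀ n)) atTop (𝓝 μ')

/-- The method diverges from `u`: arbitrarily close to `u` there are initial conditions of
power `P` whose iterates leave a fixed neighbourhood of `u`. -/
def DivergesFrom (ι : V →L[ℝ] H) (M : AccelerationOperator V) (L00 : V → StrongDual ℝ V)
    (u : V) (P Δt : ℝ) : Prop :=
  ∃ ε > 0, ∀ δ > 0, ∃ u₀ : V, ‖u₀ - u‖ < δ ∧ power ι u₀ = P ∧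
    ∃ n, ε ≤ ‖iterates ι M L00 P Δt u₀ n - u‖

/-- The method diverges from `u` for generic initial conditions: among the initial conditions
of power `P` in a neighbourhood of `u`, those whose iterates leave this neighbourhood are
dense. -/
def DivergesGenerically (ι : V →L[ℝ] H) (M : AccelerationOperator V)
    (L00 : V → StrongDual ℝ V) (u : V) (P Δt : ℝ) : Prop :=
  ∃ ε > 0, ∀ v : V, ‖v - u‖ < ε → power ι v = P → ∀ δ > 0,
    ∃ u₀ : V, ‖u₀ - v‖ < δ ∧ power ι u₀ = P ∧
      ∃ n, ε ≤ ‖iterates ι M L00 P Δt u₀ n - u‖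

end Definitions

end PCSOM

end

/-!
Near `u` the iteration maps the elements of the power of `u` into themselves, and its derivative on
`S` is `1 + Δt 𝓛_PC`. With respect to the form of `M` one has `𝓛_PC = -R*R`, where `R` is the
linearization of the residual, so the spectrum of `𝓛_PC` lies in `[Λmin, 0]` and `1 + Δt 𝓛_PC` is
symmetric.

If `Δt < -2 / Λmin`, this derivative contracts the range of `R*R`, which is closed with `L₁`, and
fixes the kernel of `L₁`. The hypotheses on the kernel and on `P'(μ)` make the solutions of power
`P` near `u` a manifold that is tangent to the kernel. Hence consecutive increments of the iteration
shrink geometrically, the iterates converge, and their limit, being stationary, lies on the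
manifold.

If `Δt > -2 / Λmin`, then `r = -(1 + Δt Λmin) > 1` is the norm of the derivative on `S`, and `Λmin`
has approximate eigenvectors. An orbit that starts along a sufficiently good one follows the
geometric progression of ratio `-r` up to a size that does not depend on the start. If some
`ν ∈ (Λmin, -2 / Δt)` is not in the spectrum, the indefinite form `⟨(ν - 𝓛_PC) x, x⟩` is expanded,
even on differences of orbits, by the factor `(1 + Δt ν)² > 1`; so two orbits whose initial
difference makes it positive cannot both stay near `u`, and any initial condition has such a partner
arbitrarily close to it.
-/

/-! ### Lipschitz continuity and derivatives near a point -/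

section LipschitzNear

variable {E F G : Type*} [NormedAddCommGroup E] [NormedAddCommGroup F]
  [NormedAddCommGroup G]

/-- `f` is Lipschitz continuous in a neighbourhood of `u`. The Lipschitz constant and the
neighbourhood are hidden in a Landau symbol for pairs of points near `u`. -/
def LipschitzNear (f : E → F) (u : E) : Prop :=
  (fun p : E × E => f p.1 - f p.2) =O[𝓝 (u, u)] fun p => p.1 - p.2

namespace LipschitzNear

variable {f : E → F} {u : E}

theorem of_lipschitzOnWith {K : NNReal} {W : Set E} (hW : W ∈ 𝓝 u) (h : LipschitzOnWith K f W) :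
    LipschitzNear f u := by
  refine .of_bound K ?_
  filter_upwards [prod_mem_nhds hW hW] with p hp
  exact h.norm_sub_le hp.1 hp.2

theorem isBigO_sub (h : LipschitzNear f u) : (fun v => f v - f u) =O[𝓝 u] fun v => v - u :=
  h.comp_tendsto (Continuous.prodMk_left u).continuousAt

theorem continuousAt (h : LipschitzNear f u) : ContinuousAt f u := by
  have hsub : Tendsto (fun v => f v - f u) (𝓝 u) (𝓝 0) :=
    h.isBigO_sub.trans_tendsto (by simpa using (continuous_sub_right u).tendsto u)
  exact tendsto_sub_nhds_zero_iff.1 hsub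

theorem eventually_nhds (h : LipschitzNear f u) : ∀ᶠ v in 𝓝 u, LipschitzNear f v := by
  obtain ⟨C, hC⟩ := h.bound
  filter_upwards [(continuous_id.prodMk continuous_id).tendsto u |>.eventually
    (eventually_eventually_nhds.2 hC)] with v hv
  exact .of_bound C hv

theorem tendsto_prodMap (h : LipschitzNear f u) :
    Tendsto (Prod.map f f) (𝓝 (u, u)) (𝓝 (f u, f u)) :=
  h.continuousAt.prodMap h.continuousAt

theorem comp {g : F → G} (hg : LipschitzNear g (f u)) (hf : LipschitzNear f u) :
    LipschitzNear (fun v => g (f v)) u :=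
  (hg.comp_tendsto hf.tendsto_prodMap).trans hf

theorem prodMk {g : E → G} (hf : LipschitzNear f u) (hg : LipschitzNear g u) :
    LipschitzNear (fun v => (f v, g v)) u :=
  hf.prod_left hg

theorem isBigO_fst (h : LipschitzNear f u) :
    (fun p : E × E => ‖f p.1 - f u‖) =O[𝓝 (u, u)] fun p => ‖p.1 - u‖ + ‖p.2 - u‖ := by
  refine (h.isBigO_sub.comp_tendsto (tendsto_fst.mono_left nhds_prod_eq.le)).norm_left.trans
    (.of_norm_le fun p => ?_)
  simp

theorem isBigO_snd (h : LipschitzNear f u) :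
    (fun p : E × E => ‖f p.2 - f u‖) =O[𝓝 (u, u)] fun p => ‖p.1 - u‖ + ‖p.2 - u‖ := by
  refine (h.isBigO_sub.comp_tendsto (tendsto_snd.mono_left nhds_prod_eq.le)).norm_left.trans
    (.of_norm_le fun p => ?_)
  simp

end LipschitzNear

end LipschitzNear

section HasLipFDerivAt

open Asymptotics

variable {𝕜 E F G : Type*} [NontriviallyNormedField 𝕜]
  [NormedAddCommGroup E] [NormedSpace 𝕜 E] [NormedAddCommGroup F] [NormedSpace 𝕜 F]
  [NormedAddCommGroup G] [NormedSpace 𝕜 G]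

/-- `f` is differentiable at `u` with derivative `f'`, and the remainder has, near `u`, a Lipschitz
constant that is linear in the distance to `u`. This is what a Lipschitz continuous derivative
gives; unlike the latter, it asks for differentiability at the point `u` only. -/
def HasLipFDerivAt (f : E → F) (f' : E →L[𝕜] F) (u : E) : Prop :=
  (fun p : E × E => f p.1 - f p.2 - f' (p.1 - p.2)) =O[𝓝 (u, u)]
    fun p => (‖p.1 - u‖ + ‖p.2 - u‖) * ‖p.1 - p.2‖

namespace HasLipFDerivAt

variable {f : E → F} {f' : E →L[𝕜] F} {g : F → G} {g' : F →L[𝕜] G} {u : E}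

theorem hasStrictFDerivAt (h : HasLipFDerivAt f f' u) : HasStrictFDerivAt f f' u := by
  have hcont : Continuous fun p : E × E => ‖p.1 - u‖ + ‖p.2 - u‖ := by fun_prop
  have hdist : (fun p : E × E => ‖p.1 - u‖ + ‖p.2 - u‖) =o[𝓝 (u, u)] fun _ => (1 : ℝ) :=
    (isLittleO_one_iff ℝ).2 (by simpa using hcont.tendsto (u, u))
  have hmul := hdist.mul_isBigO (isBigO_refl (fun p : E × E => ‖p.1 - p.2‖) (𝓝 (u, u)))
  simp only [one_mul] at hmul
  exact .of_isLittleO (h.trans_isLittleO hmul.of_norm_right)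

theorem lipschitzNear (h : HasLipFDerivAt f f' u) : LipschitzNear f u :=
  h.hasStrictFDerivAt.isBigO_sub

protected theorem id : HasLipFDerivAt (fun v : E => v) (ContinuousLinearMap.id 𝕜 E) u :=
  (isBigO_zero _ _).congr_left fun p => by simp

theorem clm_comp (L : F →L[𝕜] G) (hf : HasLipFDerivAt f f' u) :
    HasLipFDerivAt (fun v => L (f v)) (L ∘L f') u :=
  ((L.isBigO_comp _ _).trans hf).congr_left fun p => by simp [map_sub]

theorem comp (hg : HasLipFDerivAt g g' (f u)) (hf : HasLipFDerivAt f f' u) :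
    HasLipFDerivAt (fun v => g (f v)) (g' ∘L f') u := by
  have hl := hf.lipschitzNear
  have houter := (hg.comp_tendsto hl.tendsto_prodMap).trans
    ((hl.isBigO_fst.add hl.isBigO_snd).mul hl.norm_norm)
  exact (houter.add ((g'.isBigO_comp _ _).trans hf)).congr_left fun p => by simp [map_sub]

theorem sub {g : E → F} {g' : E →L[𝕜] F} (hf : HasLipFDerivAt f f' u)
    (hg : HasLipFDerivAt g g' u) : HasLipFDerivAt (fun v => f v - g v) (f' - g') u := by
  refine (IsBigO.sub hf hg).congr_left fun p => ?_
  simp only [_root_.sub_apply]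
  abel

theorem const_smul (c : 𝕜) (hf : HasLipFDerivAt f f' u) :
    HasLipFDerivAt (fun v => c • f v) (c • f') u :=
  (IsBigO.const_smul_left hf c).congr_left fun p => by simp [smul_sub]

/-- Because `f` vanishes at `u`, the other factor `a` need not be differentiable. -/
theorem lipschitz_clm_apply {a : E → F →L[𝕜] G} (ha : LipschitzNear a u)
    (hf : HasLipFDerivAt f f' u) (h0 : f u = 0) :
    HasLipFDerivAt (fun v => a v (f v)) (a u ∘L f') u := by
  have happ : ∀ (A : E × E → F →L[𝕜] G) (x : E × E → F),
      (fun p => A p (x p)) =O[𝓝 (u, u)] fun p => ‖A p‖ * ‖x p‖ := fun A x =>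
    .of_norm_le fun p => (A p).le_opNorm (x p)
  have hbdd : (fun p : E × E => ‖a p.1‖) =O[𝓝 (u, u)] fun _ => (1 : ℝ) :=
    (ContinuousAt.comp (f := Prod.fst) (x := ((u, u) : E × E))
      ha.continuousAt continuousAt_fst).norm.isBigO_one ℝ
  have hremainder : (fun p : E × E => a p.1 (f p.1 - f p.2 - f' (p.1 - p.2))) =O[𝓝 (u, u)]
      fun p => (‖p.1 - u‖ + ‖p.2 - u‖) * ‖p.1 - p.2‖ :=
    (happ _ _).trans ((hbdd.mul hf.norm_left).congr_right fun p => one_mul _)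
  have hlinear : (fun p : E × E => (a p.1 - a u) (f' (p.1 - p.2))) =O[𝓝 (u, u)]
      fun p => (‖p.1 - u‖ + ‖p.2 - u‖) * ‖p.1 - p.2‖ :=
    (happ _ _).trans (ha.isBigO_fst.mul (f'.isBigO_comp _ _).norm_norm)
  have hfactor : (fun p : E × E => (a p.1 - a p.2) (f p.2)) =O[𝓝 (u, u)]
      fun p => (‖p.1 - u‖ + ‖p.2 - u‖) * ‖p.1 - p.2‖ := by
    have hsmall : (fun p : E × E => ‖f p.2‖) =O[𝓝 (u, u)] fun p => ‖p.1 - u‖ + ‖p.2 - u‖ := by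
      simpa only [h0, sub_zero] using hf.lipschitzNear.isBigO_snd
    exact (happ _ _).trans ((ha.norm_norm.mul hsmall).congr_right fun p => mul_comm _ _)
  refine ((hremainder.add hlinear).add hfactor).congr_left fun p => ?_
  simp only [ContinuousLinearMap.comp_apply, _root_.sub_apply, map_sub]
  abel

theorem isBigO_sub_sq (hf : HasLipFDerivAt f f' u) :
    (fun v => f v - f u - f' (v - u)) =O[𝓝 u] fun v => ‖v - u‖ ^ 2 := by
  have hlim : Tendsto (fun v : E => (v, u)) (𝓝 u) (𝓝 (u, u)) :=
    tendsto_id.prodMk_nhds tendsto_const_nhds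
  exact (hf.comp_tendsto hlim).congr_right fun v => by simp [sq]

end HasLipFDerivAt

end HasLipFDerivAt

section ContDiffAt

variable {E F : Type*} [NormedAddCommGroup E] [NormedSpace ℝ E]
  [NormedAddCommGroup F] [NormedSpace ℝ F] {f : E → F} {u : E}

theorem LipschitzNear.of_contDiffAt (h : ContDiffAt ℝ 1 f u) : LipschitzNear f u :=
  (h.hasStrictFDerivAt one_ne_zero).isBigO_sub

theorem HasLipFDerivAt.of_lipschitzNear_fderiv (hd : ∀ᶠ v in 𝓝 u, DifferentiableAt ℝ f v)
    (hl : LipschitzNear (fderiv ℝ f) u) : HasLipFDerivAt f (fderiv ℝ f u) u := by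
  obtain ⟨K, hK0, hK⟩ := hl.isBigO_sub.exists_pos
  obtain ⟨r, hr, hball⟩ := Metric.eventually_nhds_iff_ball.1 (hd.and hK.bound)
  refine .of_bound K ?_
  filter_upwards [prod_mem_nhds (Metric.ball_mem_nhds u hr) (Metric.ball_mem_nhds u hr)]
    with ⟨v, w⟩ ⟨hv, hw⟩
  set ρ := max ‖v - u‖ ‖w - u‖
  have hsub : Metric.closedBall u ρ ⊆ Metric.ball u r :=
    Metric.closedBall_subset_ball (max_lt (mem_ball_iff_norm.1 hv) (mem_ball_iff_norm.1 hw))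
  have hbound : ∀ x ∈ Metric.closedBall u ρ, ‖fderiv ℝ f x - fderiv ℝ f u‖ ≤ K * ρ := fun x hx =>
    (hball x (hsub hx)).2.trans (by gcongr; exact mem_closedBall_iff_norm.1 hx)
  calc ‖f v - f w - fderiv ℝ f u (v - w)‖ ≤ K * ρ * ‖v - w‖ :=
        (convex_closedBall u ρ).norm_image_sub_le_of_norm_fderiv_le'
          (fun x hx => (hball x (hsub hx)).1) hbound
          (mem_closedBall_iff_norm.2 (le_max_right _ _))
          (mem_closedBall_iff_norm.2 (le_max_left _ _))
    _ ≤ K * ‖(‖v - u‖ + ‖w - u‖) * ‖v - w‖‖ := by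
        rw [Real.norm_of_nonneg (by positivity), mul_assoc]
        gcongr
        exact max_le_add_of_nonneg (norm_nonneg _) (norm_nonneg _)

theorem HasLipFDerivAt.of_contDiffAt (h : ContDiffAt ℝ 2 f u) :
    HasLipFDerivAt f (fderiv ℝ f u) u := by
  refine .of_lipschitzNear_fderiv ?_ (.of_contDiffAt (h.fderiv_right (m := 1) (by norm_num)))
  filter_upwards [h.eventually (by simp)] with v hv
  exact hv.differentiableAt (by simp)

end ContDiffAt

/-! ### Coercive symmetric forms -/

section SymmetricForms

variable {X : Type*} [NormedAddCommGroup X] [NormedSpace ℝ X] {b : X →L[ℝ] StrongDual ℝ X}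

theorem apply_self_le_opNorm_mul_sq (b : X →L[ℝ] StrongDual ℝ X) (x : X) :
    b x x ≤ ‖b‖ * ‖x‖ ^ 2 :=
  (le_abs_self _).trans ((b.le_opNorm₂ x x).trans_eq (by ring))

theorem apply_sq_le_mul_of_nonneg (hs : ∀ x y, b x y = b y x) (h0 : ∀ x, 0 ≤ b x x) (x y : X) :
    b x y ^ 2 ≤ b x x * b y y :=
  LinearMap.BilinForm.apply_sq_le_of_symm b.toLinearMap₁₂ h0 ⟨hs⟩ x y

theorem norm_apply_sq_le (hs : ∀ x y, b x y = b y x) (h0 : ∀ x, 0 ≤ b x x) (x : X) :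
    ‖b x‖ ^ 2 ≤ ‖b‖ * b x x := by
  have hprod : 0 ≤ ‖b‖ * b x x := mul_nonneg (norm_nonneg b) (h0 x)
  refine (Real.le_sqrt (norm_nonneg _) hprod).1 ?_
  refine ContinuousLinearMap.opNorm_le_bound _ (Real.sqrt_nonneg _) fun y => ?_
  refine abs_le_of_sq_le_sq ?_ (by positivity)
  calc b x y ^ 2 ≤ b x x * b y y := apply_sq_le_mul_of_nonneg hs h0 x y
    _ ≤ b x x * (‖b‖ * ‖y‖ ^ 2) := by gcongr; exacts [h0 x, apply_self_le_opNorm_mul_sq b y]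
    _ = (√(‖b‖ * b x x) * ‖y‖) ^ 2 := by rw [mul_pow, Real.sq_sqrt hprod]; ring

theorem isCoercive_of_mul_norm_le (hs : ∀ x y, b x y = b y x) (h0 : ∀ x, 0 ≤ b x x) {c : ℝ}
    (hc : 0 < c) (h : ∀ x, c * ‖x‖ ≤ ‖b x‖) : IsCoercive b := by
  refine ⟨c ^ 2 / (‖b‖ + 1), by positivity, fun x => ?_⟩
  rw [mul_assoc, div_mul_eq_mul_div, div_le_iff₀ (by positivity)]
  calc c ^ 2 * (‖x‖ * ‖x‖) = (c * ‖x‖) ^ 2 := by ring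
    _ ≤ ‖b x‖ ^ 2 := by gcongr; exact h x
    _ ≤ ‖b‖ * b x x := norm_apply_sq_le hs h0 x
    _ ≤ b x x * (‖b‖ + 1) := by linarith [h0 x]

theorem apply_self_nonneg_of_isCoercive (hb : IsCoercive b) (x : X) : 0 ≤ b x x := by
  obtain ⟨c, hc, hco⟩ := hb
  exact le_trans (by positivity) (hco x)

theorem apply_self_pos_of_isCoercive (hb : IsCoercive b) {x : X} (hx : x ≠ 0) : 0 < b x x := by
  obtain ⟨c, hc, hco⟩ := hb
  have := norm_pos_iff.2 hx
  exact lt_of_lt_of_le (by positivity) (hco x)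

theorem exists_mul_norm_le_of_isCoercive (hb : IsCoercive b) :
    ∃ c > 0, ∀ x, c * ‖x‖ ≤ ‖b x‖ := by
  obtain ⟨c, hc, hco⟩ := hb
  refine ⟨c, hc, fun x => ?_⟩
  rcases eq_or_ne x 0 with rfl | hx
  · simp
  refine le_of_mul_le_mul_right ?_ (norm_pos_iff.2 hx)
  exact (hco x).trans ((le_abs_self _).trans ((b x).le_opNorm x))

theorem exists_forall_mul_norm_le_of_notMem_spectrum {𝕜 E : Type*} [NontriviallyNormedField 𝕜]
    [NormedAddCommGroup E] [NormedSpace 𝕜 E] {T : E →L[𝕜] E} {lam : 𝕜} (h : lam ∉ spectrum 𝕜 T) :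
    ∃ c > 0, ∀ x, c * ‖x‖ ≤ ‖T x - lam • x‖ := by
  obtain ⟨S, hS⟩ := (spectrum.notMem_iff.1 h).exists_left_inv
  have hinv : ∀ x, S (lam • x - T x) = x := fun x => by
    simpa [Algebra.algebraMap_eq_smul_one] using congr($hS x)
  refine ⟨(‖S‖ + 1)⁻¹, by positivity, fun x => ?_⟩
  rw [inv_mul_le_iff₀ (by positivity)]
  calc ‖x‖ = ‖S (lam • x - T x)‖ := by rw [hinv]
    _ ≤ ‖S‖ * ‖lam • x - T x‖ := S.le_opNorm _
    _ ≤ (‖S‖ + 1) * ‖T x - lam • x‖ := by rw [norm_sub_rev]; gcongr; simp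

theorem exists_strongDual_ne_zero_of_notMem_of_isClosed {R : Submodule ℝ X}
    (hR : IsClosed (R : Set X)) {z : X} (hz : z ∉ R) :
    ∃ f : StrongDual ℝ X, (∀ x ∈ R, f x = 0) ∧ f z ≠ 0 := by
  have : IsClosed (R : Set X) := hR
  obtain ⟨f, hf⟩ := SeparatingDual.exists_ne_zero (R := ℝ)
    (mt (Submodule.Quotient.mk_eq_zero R).1 hz)
  refine ⟨f ∘L R.mkQL, fun x hx => ?_, hf⟩
  simp [(Submodule.Quotient.mk_eq_zero R).2 hx]

/-- The annihilator of the range of `N` is represented by vectors in the kernel of `N`, which is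
trivial; so the range, which is closed, is everything. -/
theorem bijective_of_symmetric_of_mul_norm_le [CompleteSpace X] (hb : IsCoercive b)
    (hsurj : Function.Surjective b) {N : X →L[ℝ] X} (hN : ∀ x y, b (N x) y = b x (N y)) {c : ℝ}
    (hc : 0 < c) (h : ∀ x, c * ‖x‖ ≤ ‖N x‖) : Function.Bijective N := by
  have hanti : AntilipschitzWith (Real.toNNReal c⁻¹) N :=
    AddMonoidHomClass.antilipschitz_of_bound N fun x => by
      rw [Real.coe_toNNReal _ (by positivity), ← div_eq_inv_mul, le_div_iff₀ hc, mul_comm]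
      exact h x
  refine ⟨hanti.injective, fun z => ?_⟩
  by_contra hz
  have hclosed : IsClosed ((N : X →ₗ[ℝ] X).range : Set X) := by
    rw [LinearMap.coe_range]
    exact hanti.isClosed_range N.uniformContinuous
  obtain ⟨f, hf, hfz⟩ := exists_strongDual_ne_zero_of_notMem_of_isClosed hclosed
    (z := z) (by simpa using hz)
  obtain ⟨y, rfl⟩ := hsurj f
  have hNy : N y = 0 := by
    by_contra hne
    refine (apply_self_pos_of_isCoercive hb hne).ne' ?_
    rw [hN]
    exact hf _ ⟨N y, rfl⟩
  have hy : y = 0 := hanti.injective (by simpa using hNy)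
  simp [hy] at hfz

theorem exists_norm_sub_smul_le_of_mem_spectrum [CompleteSpace X] (hb : IsCoercive b)
    (hsurj : Function.Surjective b) {T : X →L[ℝ] X} (hT : ∀ x y, b (T x) y = b x (T y)) {lam : ℝ}
    (h : lam ∈ spectrum ℝ T) {η : ℝ} (hη : 0 < η) : ∃ x ≠ 0, ‖T x - lam • x‖ ≤ η * ‖x‖ := by
  by_contra! hcon
  have happ : ∀ x, (algebraMap ℝ (X →L[ℝ] X) lam - T) x = lam • x - T x := fun x => by
    simp [Algebra.algebraMap_eq_smul_one]
  refine spectrum.mem_iff.1 h (ContinuousLinearMap.isUnit_iff_bijective.2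
    (bijective_of_symmetric_of_mul_norm_le hb hsurj (fun x y => ?_) hη fun x => ?_))
  · simp [happ, hT]
  · rcases eq_or_ne x 0 with rfl | hx
    · simp
    · rw [happ, norm_sub_rev]
      exact (hcon x hx).le

theorem exists_lt_forall_mul_apply_self_le (hb : IsCoercive b) (hs : ∀ x y, b x y = b y x)
    {T : X →L[ℝ] X} (hT : ∀ x y, b (T x) y = b x (T y)) {m : ℝ} (hm : m ∉ spectrum ℝ T)
    (hle : ∀ x, m * b x x ≤ b (T x) x) : ∃ m' > m, ∀ x, m' * b x x ≤ b (T x) x := by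
  set N : X →L[ℝ] X := T - m • ContinuousLinearMap.id ℝ X with hNdef
  have hN : ∀ x, N x = T x - m • x := fun x => by simp [hNdef]
  obtain ⟨d, hd, hdN⟩ := exists_forall_mul_norm_le_of_notMem_spectrum hm
  obtain ⟨c, hc, hcb⟩ := exists_mul_norm_le_of_isCoercive hb
  obtain ⟨k, hk, hkN⟩ : IsCoercive (b ∘L N) := by
    refine isCoercive_of_mul_norm_le (c := c * d) (fun x y => ?_) (fun x => ?_)
      (mul_pos hc hd) fun x => ?_
    · simp [hN, hT, hs x y, hs x (T y)]
    · simpa [hN] using hle x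
    · calc c * d * ‖x‖ = c * (d * ‖x‖) := mul_assoc _ _ _
        _ ≤ c * ‖N x‖ := by gcongr; rw [hN]; exact hdN x
        _ ≤ ‖b (N x)‖ := hcb _
  refine ⟨m + k / (‖b‖ + 1), lt_add_of_pos_right _ (by positivity), fun x => ?_⟩
  have hgap : k / (‖b‖ + 1) * b x x ≤ b (T x) x - m * b x x := by
    calc k / (‖b‖ + 1) * b x x ≤ k / (‖b‖ + 1) * ((‖b‖ + 1) * ‖x‖ ^ 2) := by
          gcongr
          exact (apply_self_le_opNorm_mul_sq b x).trans (by gcongr; simp)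
      _ = k * ‖x‖ * ‖x‖ := by field_simp
      _ ≤ b (T x) x - m * b x x := by simpa [hN] using hkN x
  linarith

theorem exists_forall_mul_apply_self_le (hb : IsCoercive b) (T : X →L[ℝ] X) :
    ∃ m, ∀ x, m * b x x ≤ b (T x) x := by
  obtain ⟨c, hc, hco⟩ := hb
  refine ⟨-(‖b ∘L T‖ / c), fun x => ?_⟩
  have hlower : -b (T x) x ≤ ‖b ∘L T‖ * ‖x‖ ^ 2 :=
    (neg_le_abs _).trans (((b ∘L T).le_opNorm₂ x x).trans_eq (by ring))
  have hupper : ‖b ∘L T‖ * ‖x‖ ^ 2 ≤ ‖b ∘L T‖ / c * b x x := by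
    rw [div_mul_eq_mul_div, le_div_iff₀ hc]
    calc ‖b ∘L T‖ * ‖x‖ ^ 2 * c = ‖b ∘L T‖ * (c * ‖x‖ * ‖x‖) := by ring
      _ ≤ ‖b ∘L T‖ * b x x := by gcongr; exact hco x
  linarith

/-- The infimum of the Rayleigh quotient belongs to the spectrum, because it could be increased
otherwise. -/
theorem mul_apply_self_le_of_isLeast_spectrum (hb : IsCoercive b) (hs : ∀ x y, b x y = b y x)
    {T : X →L[ℝ] X} (hT : ∀ x y, b (T x) y = b x (T y)) {lam : ℝ}
    (h : IsLeast (spectrum ℝ T) lam) (x : X) : lam * b x x ≤ b (T x) x := by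
  by_contra! hx
  set A : Set ℝ := {m | ∀ y, m * b y y ≤ b (T y) y}
  have hlt : ∀ m ∈ A, m < lam := fun m hm =>
    lt_of_mul_lt_mul_right ((hm x).trans_lt hx) (apply_self_nonneg_of_isCoercive hb x)
  have hbdd : BddAbove A := ⟨lam, fun m hm => (hlt m hm).le⟩
  have hclosed : IsClosed A := by
    simp only [A, Set.ofPred_forall]
    exact isClosed_iInter fun y => isClosed_le (by fun_prop) continuous_const
  have hsup : sSup A ∈ A := hclosed.csSup_mem (exists_forall_mul_apply_self_le hb T) hbdd
  obtain ⟨m, hm, hmA⟩ := exists_lt_forall_mul_apply_self_le hb hs hT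
    (fun hspec => (hlt _ hsup).not_ge (h.2 hspec)) hsup
  exact hm.not_ge (le_csSup hbdd hmA)

end SymmetricForms

namespace AccelerationOperator

variable {V : Type*} [NormedAddCommGroup V] [NormedSpace ℝ V]

theorem completeSpace (M : AccelerationOperator V) : CompleteSpace V :=
  (completeSpace_congr (e := M.op.toEquiv) M.op.isUniformEmbedding).2 inferInstance

variable (M : AccelerationOperator V)

theorem op_self_nonneg (x : V) : 0 ≤ M.op x x := by
  rcases eq_or_ne x 0 with rfl | hx
  · simp
  · exact (M.posDef x hx).le

theorem op_sq_le (x y : V) : M.op x y ^ 2 ≤ M.op x x * M.op y y :=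
  apply_sq_le_mul_of_nonneg (b := (M.op : V →L[ℝ] StrongDual ℝ V)) M.hermitian M.op_self_nonneg x y

theorem isCoercive : IsCoercive (M.op : V →L[ℝ] StrongDual ℝ V) := by
  refine isCoercive_of_mul_norm_le (c := (‖(M.op.symm : StrongDual ℝ V →L[ℝ] V)‖ + 1)⁻¹)
    M.hermitian M.op_self_nonneg (by positivity) fun x => ?_
  rw [inv_mul_le_iff₀ (by positivity)]
  calc ‖x‖ = ‖M.op.symm (M.op x)‖ := by rw [M.op.symm_apply_apply]
    _ ≤ ‖(M.op.symm : StrongDual ℝ V →L[ℝ] V)‖ * ‖M.op x‖ :=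
      (M.op.symm : StrongDual ℝ V →L[ℝ] V).le_opNorm _
    _ ≤ (‖(M.op.symm : StrongDual ℝ V →L[ℝ] V)‖ + 1) * ‖M.op x‖ := by gcongr; simp

/-- The energy norm `√⟨M x, x⟩` of an acceleration operator, in which the linearized iteration is
symmetric. It is equivalent to the norm of `V` but kept as a seminorm beside it. -/
noncomputable def energyNorm : Seminorm ℝ V :=
  Seminorm.of (fun x => √(M.op x x))
    (fun x y => by
      refine Real.sqrt_le_iff.2 ⟨by positivity, ?_⟩
      rw [add_sq, Real.sq_sqrt (M.op_self_nonneg x), Real.sq_sqrt (M.op_self_nonneg y)]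
      have h : M.op x y ≤ √(M.op x x) * √(M.op y y) := by
        rw [← Real.sqrt_mul (M.op_self_nonneg x)]
        exact Real.le_sqrt_of_sq_le (M.op_sq_le x y)
      simp only [map_add, _root_.add_apply]
      linarith [M.hermitian x y])
    (fun a x => by
      simp only [map_smul, _root_.smul_apply, smul_eq_mul]
      rw [← mul_assoc, Real.sqrt_mul (mul_self_nonneg a), Real.sqrt_mul_self_eq_abs,
        Real.norm_eq_abs])

theorem energyNorm_sq (x : V) : M.energyNorm x ^ 2 = M.op x x :=
  Real.sq_sqrt (M.op_self_nonneg x)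

theorem abs_op_le_energyNorm_mul (x y : V) : |M.op x y| ≤ M.energyNorm x * M.energyNorm y := by
  refine abs_le_of_sq_le_sq ?_ (mul_nonneg (apply_nonneg _ _) (apply_nonneg _ _))
  rw [mul_pow, energyNorm_sq, energyNorm_sq]
  exact M.op_sq_le x y

theorem continuous_energyNorm : Continuous M.energyNorm := by
  have h : Continuous fun x => M.op x x := by fun_prop
  exact h.sqrt

theorem exists_energyNorm_le : ∃ C > 0, ∀ x, M.energyNorm x ≤ C * ‖x‖ := by
  refine ⟨√(‖(M.op : V →L[ℝ] StrongDual ℝ V)‖ + 1), by positivity, fun x => ?_⟩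
  refine le_of_sq_le_sq ?_ (by positivity)
  rw [energyNorm_sq, mul_pow, Real.sq_sqrt (by positivity)]
  exact (apply_self_le_opNorm_mul_sq (M.op : V →L[ℝ] StrongDual ℝ V) x).trans (by gcongr; simp)

theorem exists_le_energyNorm : ∃ c > 0, ∀ x, c * ‖x‖ ≤ M.energyNorm x := by
  obtain ⟨c, hc, h⟩ := M.isCoercive
  refine ⟨√c, by positivity, fun x => ?_⟩
  refine le_of_sq_le_sq ?_ (apply_nonneg _ _)
  rw [energyNorm_sq, mul_pow, Real.sq_sqrt hc.le, sq, ← mul_assoc]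
  exact h x

end AccelerationOperator

/-! ### The iteration and its linearization -/

namespace PCSOM

variable {V H : Type*} [NormedAddCommGroup V] [NormedSpace ℝ V]
  [NormedAddCommGroup H] [InnerProductSpace ℝ H]

section Power

variable (ι : V →L[ℝ] H)

theorem ip_comm (v w : V) : ip ι v w = ip ι w v := real_inner_comm _ _

theorem power_eq_norm_sq (v : V) : power ι v = ‖ι v‖ ^ 2 := real_inner_self_eq_norm_sq _

theorem power_nonneg (v : V) : 0 ≤ power ι v := by
  rw [power_eq_norm_sq]
  positivity

theorem power_smul (a : ℝ) (v : V) : power ι (a • v) = a ^ 2 * power ι v := by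
  rw [power_eq_norm_sq, power_eq_norm_sq, map_smul, norm_smul, mul_pow, Real.norm_eq_abs, sq_abs]

variable {ι} in
theorem embed_ne_zero_of_power_ne_zero {v : V} (h : power ι v ≠ 0) : embed ι v ≠ 0 := fun h0 =>
  h (by rw [power, ← embed_apply, h0]; rfl)

theorem contDiff_power {n : WithTop ℕ∞} : ContDiff ℝ n (power ι) := by
  have : ContDiff ℝ n fun v => embed ι v v := by fun_prop
  exact this

theorem hasFDerivAt_power (u : V) : HasFDerivAt (power ι) ((2 : ℝ) • embed ι u) u := by
  refine ((embed ι).hasFDerivAt.clm_apply (hasFDerivAt_id u)).congr_fderiv ?_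
  ext x
  simp [embed_apply, ip_comm ι x u, two_mul]

/-- Scaling of `v` to the power `P`. -/
noncomputable def normalize (P : ℝ) (v : V) : V := √(P / power ι v) • v

theorem power_normalize {P : ℝ} (hP : 0 ≤ P) {v : V} (hv : power ι v ≠ 0) :
    power ι (normalize ι P v) = P := by
  rw [normalize, power_smul, Real.sq_sqrt (div_nonneg hP (power_nonneg ι v)),
    div_mul_cancel₀ _ hv]

variable {ι} in
theorem normalize_power {v : V} (hv : power ι v ≠ 0) : normalize ι (power ι v) v = v := by
  rw [normalize, div_self hv, Real.sqrt_one, one_smul]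

/-- The projection onto `S` along `u`, which is the derivative at `u` of the scaling to the power
of `u`. -/
noncomputable def radialProj (u : V) : V →L[ℝ] V :=
  ContinuousLinearMap.id ℝ V - (power ι u)⁻¹ • (embed ι u).smulRight u

variable {ι} in
theorem radialProj_of_embed_eq_zero {u x : V} (hx : embed ι u x = 0) : radialProj ι u x = x := by
  simp [radialProj, hx]

theorem hasFDerivAt_normalize {u : V} (hu : power ι u ≠ 0) :
    HasFDerivAt (normalize ι (power ι u)) (radialProj ι u) u := by
  have hquot : HasFDerivAt (fun v => power ι u / power ι v)
      (-(2 * (power ι u)⁻¹) • embed ι u) u := by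
    refine (((hasDerivAt_inv hu).const_mul (power ι u)).comp_hasFDerivAt u
      (hasFDerivAt_power ι u)).congr_fderiv ?_
    rw [smul_smul]
    congr 1
    field_simp
  refine ((hquot.sqrt (by simp [hu])).smul (hasFDerivAt_id u)).congr_fderiv ?_
  ext x
  simp only [div_self hu, Real.sqrt_one, ContinuousLinearMap.smulRight_apply, radialProj,
    _root_.add_apply, _root_.sub_apply, _root_.smul_apply, ContinuousLinearMap.id_apply, id_eq,
    smul_eq_mul]
  module

theorem hasLipFDerivAt_normalize {u : V} (hu : power ι u ≠ 0) :
    HasLipFDerivAt (normalize ι (power ι u)) (radialProj ι u) u := by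
  have hcont : ContDiffAt ℝ 2 (normalize ι (power ι u)) u :=
    ((contDiffAt_const.div (contDiff_power ι).contDiffAt hu).sqrt (by simp [hu])).smul contDiffAt_id
  exact (hasFDerivAt_normalize ι hu).fderiv ▸ .of_contDiffAt hcont

end Power

section OrthProj

variable (ι : V →L[ℝ] H) (M : AccelerationOperator V)

theorem op_Minv (f : StrongDual ℝ V) : M.op (Minv M f) = f := M.op.apply_symm_apply f

/-- The projection onto `S` that is orthogonal with respect to the form of `M`. The multipliers
`γ`, `γ̂`, `β` and the Rayleigh quotient all amount to an application of it. -/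
noncomputable def orthProj (u : V) : V →L[ℝ] V :=
  ContinuousLinearMap.id ℝ V - (denom ι M u)⁻¹ • (embed ι u).smulRight (Minv M (embed ι u))

theorem orthProj_apply (u x : V) : orthProj ι M u x =
    x - ((denom ι M u)⁻¹ * embed ι u x) • Minv M (embed ι u) := by
  simp [orthProj, smul_smul]

theorem orthProj_Minv_embed (u : V) : orthProj ι M u (Minv M (embed ι u)) = 0 := by
  by_cases hu : embed ι u = 0
  · simp [hu]
  · have hd : (denom ι M u)⁻¹ * embed ι u (Minv M (embed ι u)) = 1 :=
      inv_mul_cancel₀ (denom_ne_zero ι M u hu)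
    rw [orthProj_apply, hd, one_smul, sub_self]

theorem op_orthProj_apply (u x y : V) : M.op (orthProj ι M u x) y = M.op x (orthProj ι M u y) := by
  have h : M.op x (Minv M (embed ι u)) = embed ι u x := by rw [M.hermitian, op_Minv]
  simp only [orthProj_apply, map_sub, map_smul, op_Minv, _root_.sub_apply, _root_.smul_apply,
    smul_eq_mul, h]
  ring

theorem embed_orthProj (u x : V) : embed ι u (orthProj ι M u x) = 0 := by
  rw [← op_Minv M (embed ι u), ← op_orthProj_apply, orthProj_Minv_embed, map_zero,
    _root_.zero_apply]

variable {ι} in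
theorem orthProj_of_embed_eq_zero {u x : V} (hx : embed ι u x = 0) : orthProj ι M u x = x := by
  simp [orthProj_apply, hx]

theorem orthProj_Minv (u : V) (f : StrongDual ℝ V) : orthProj ι M u (Minv M f) =
    Minv M (f - (embed ι u (Minv M f) / denom ι M u) • embed ι u) := by
  rw [orthProj_apply, map_sub, map_smul, div_eq_inv_mul]

theorem contDiffAt_orthProj {n : WithTop ℕ∞} {u : V} (hu : embed ι u ≠ 0) :
    ContDiffAt ℝ n (orthProj ι M) u := by
  have hden : ContDiffAt ℝ n (fun v => (embed ι v (Minv M (embed ι v)))⁻¹) u :=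
    ContDiffAt.inv (by fun_prop) (denom_ne_zero ι M u hu)
  have hproj : ContDiffAt ℝ n (fun v => (embed ι v).smulRight (Minv M (embed ι v))) u :=
    ContDiffAt.smulRight (by fun_prop) (by fun_prop)
  exact contDiffAt_const.sub (hden.smul hproj)

end OrthProj

section Step

variable (ι : V →L[ℝ] H) (M : AccelerationOperator V) (L00 : V → StrongDual ℝ V)

/-- The residual `M⁻¹ L₀ v`, with the Rayleigh quotient of `v` in the place of `μ`. -/
noncomputable def residual (v : V) : V := Minv M (L0 ι L00 (rayleigh ι M L00 v) v)

theorem residual_eq_orthProj (μ : ℝ) (v : V) :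
    residual ι M L00 v = orthProj ι M v (Minv M (L0 ι L00 μ v)) := by
  rw [L0, map_sub, map_smul, map_sub, map_smul, orthProj_Minv_embed, smul_zero, sub_zero,
    orthProj_Minv]
  rfl

theorem predictor_eq (Δt : ℝ) (v : V) : predictor ι M L00 Δt v = v - Δt • orthProj ι M v
    (Minv M (L1adj ι L00 (rayleigh ι M L00 v) v (residual ι M L00 v))) := by
  rw [orthProj_Minv]
  rfl

/-- The linearization of the residual, `Ψ ↦ M⁻¹ (L₁ Ψ - β u)`. -/
noncomputable def residualDeriv (μ : ℝ) (u : V) : V →L[ℝ] V :=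
  orthProj ι M u ∘L Minv M ∘L L1 ι L00 μ u

theorem LPCfull_eq (μ : ℝ) (u : V) : LPCfull ι M L00 μ u =
    -(orthProj ι M u ∘L Minv M ∘L L1adj ι L00 μ u ∘L residualDeriv ι M L00 μ u) := by
  have hLhat : ∀ x, Lhat ι M L00 μ u x = -L1adj ι L00 μ u (residualDeriv ι M L00 μ u x) := by
    intro x
    simp only [residualDeriv, ContinuousLinearMap.comp_apply, orthProj_Minv, div_eq_inv_mul]
    rfl
  ext x
  calc LPCfull ι M L00 μ u x = orthProj ι M u (Minv M (Lhat ι M L00 μ u x)) := by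
        rw [orthProj_Minv, div_eq_inv_mul]
        rfl
    _ = _ := by simp [hLhat]

variable {ι L00} {μ : ℝ} {u : V}

theorem residual_eq_zero (h : L0 ι L00 μ u = 0) : residual ι M L00 u = 0 := by
  rw [residual_eq_orthProj ι M L00 μ, h, map_zero, map_zero]

theorem rayleigh_eq (hu : embed ι u ≠ 0) (h : L0 ι L00 μ u = 0) : rayleigh ι M L00 u = μ := by
  rw [L0, sub_eq_zero] at h
  rw [rayleigh, h, map_smul, ← embed_apply, map_smul, smul_eq_mul,
    div_eq_iff (denom_ne_zero ι M u hu)]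
  rfl

theorem predictor_eq_self (Δt : ℝ) (h : L0 ι L00 μ u = 0) : predictor ι M L00 Δt u = u := by
  rw [predictor_eq, residual_eq_zero M h]
  simp

theorem step_eq_self (Δt : ℝ) (hu : power ι u ≠ 0) (h : L0 ι L00 μ u = 0) :
    step ι M L00 (power ι u) Δt u = u := by
  rw [step, predictor_eq_self M Δt h]
  exact normalize_power hu

theorem lipschitzNear_rayleigh (hu : embed ι u ≠ 0) (hL : LipschitzNear L00 u) :
    LipschitzNear (rayleigh ι M L00) u := by
  have hquot : ContDiffAt ℝ 1 (fun q : V × StrongDual ℝ V =>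
      embed ι q.1 (Minv M q.2) / embed ι q.1 (Minv M (embed ι q.1))) (u, L00 u) :=
    ContDiffAt.div (by fun_prop) (by fun_prop) (denom_ne_zero ι M u hu)
  exact (LipschitzNear.of_contDiffAt hquot).comp (f := fun v => (v, L00 v))
    (HasLipFDerivAt.id (𝕜 := ℝ).lipschitzNear.prodMk hL)

theorem lipschitzNear_L1adj {ν : V → ℝ} (hν : LipschitzNear ν u)
    (hX : LipschitzNear (fderiv ℝ L00) u) : LipschitzNear (fun v => L1adj ι L00 (ν v) v) u := by
  have hflip : (fun p : V × V => (fderiv ℝ L00 p.1 - fderiv ℝ L00 p.2).flip) =O[𝓝 (u, u)]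
      fun p => p.1 - p.2 :=
    .trans (.of_norm_eventuallyLE (.of_forall fun p => (ContinuousLinearMap.opNorm_flip _).le))
      hX.norm_left
  have hsmul : (fun p : V × V => (ν p.1 - ν p.2) • (embed ι).flip) =O[𝓝 (u, u)]
      fun p => p.1 - p.2 :=
    .trans (.of_bound ‖(embed ι).flip‖ (.of_forall fun p =>
      (ContinuousLinearMap.opNorm_smul_le _ _).trans_eq (mul_comm _ _))) hν
  refine (hflip.sub hsmul).congr_left fun p => ?_
  ext x y
  simp only [L1adj, L1, _root_.sub_apply,
    _root_.smul_apply, ContinuousLinearMap.flip_apply, smul_eq_mul]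
  ring

theorem lipschitzNear_orthProj_comp_L1adj (hu : embed ι u ≠ 0) (hL : LipschitzNear L00 u)
    (hX : LipschitzNear (fderiv ℝ L00) u) : LipschitzNear
      (fun v => orthProj ι M v ∘L Minv M ∘L L1adj ι L00 (rayleigh ι M L00 v) v) u := by
  have hcont : ContDiffAt ℝ 1 (fun q : V × (V →L[ℝ] StrongDual ℝ V) =>
      orthProj ι M q.1 ∘L Minv M ∘L q.2) (u, L1adj ι L00 (rayleigh ι M L00 u) u) :=
    (ContDiffAt.comp (g := orthProj ι M) _ (contDiffAt_orthProj ι M hu) contDiffAt_fst).clm_comp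
      (contDiffAt_const.clm_comp contDiffAt_snd)
  exact (LipschitzNear.of_contDiffAt hcont).comp
    (f := fun v => (v, L1adj ι L00 (rayleigh ι M L00 v) v))
    (HasLipFDerivAt.id (𝕜 := ℝ).lipschitzNear.prodMk
      (lipschitzNear_L1adj (lipschitzNear_rayleigh M hu hL) hX))

theorem hasLipFDerivAt_residual (hu : embed ι u ≠ 0) (h : L0 ι L00 μ u = 0)
    (hL : HasLipFDerivAt L00 (fderiv ℝ L00 u) u) :
    HasLipFDerivAt (residual ι M L00) (residualDeriv ι M L00 μ u) u := by
  have hL0 : HasLipFDerivAt (L0 ι L00 μ) (L1 ι L00 μ u) u :=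
    hL.sub ((HasLipFDerivAt.id.clm_comp (embed ι)).const_smul μ)
  rw [funext (residual_eq_orthProj ι M L00 μ)]
  exact (hL0.clm_comp (Minv M)).lipschitz_clm_apply
    (LipschitzNear.of_contDiffAt (contDiffAt_orthProj ι M hu)) (by rw [h, map_zero])

theorem hasLipFDerivAt_predictor (Δt : ℝ) (hu : embed ι u ≠ 0) (h : L0 ι L00 μ u = 0)
    (hL : HasLipFDerivAt L00 (fderiv ℝ L00 u) u) (hX : LipschitzNear (fderiv ℝ L00) u) :
    HasLipFDerivAt (predictor ι M L00 Δt)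
      (ContinuousLinearMap.id ℝ V + Δt • LPCfull ι M L00 μ u) u := by
  have hcorr := (hasLipFDerivAt_residual M hu h hL).lipschitz_clm_apply
    (lipschitzNear_orthProj_comp_L1adj M hu hL.lipschitzNear hX) (residual_eq_zero M h)
  rw [rayleigh_eq M hu h] at hcorr
  rw [funext (predictor_eq ι M L00 Δt), LPCfull_eq, smul_neg, ← sub_eq_add_neg]
  exact HasLipFDerivAt.id.sub (hcorr.const_smul Δt)

variable (ι L00 μ u) in
/-- The derivative of the step at a solitary wave `u`. -/
noncomputable def stepDeriv (Δt : ℝ) : V →L[ℝ] V :=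
  radialProj ι u ∘L (ContinuousLinearMap.id ℝ V + Δt • LPCfull ι M L00 μ u)

theorem hasLipFDerivAt_step (Δt : ℝ) (hu : power ι u ≠ 0) (h : L0 ι L00 μ u = 0)
    (hL : HasLipFDerivAt L00 (fderiv ℝ L00 u) u) (hX : LipschitzNear (fderiv ℝ L00) u) :
    HasLipFDerivAt (step ι M L00 (power ι u) Δt) (stepDeriv ι M L00 μ u Δt) u := by
  refine HasLipFDerivAt.comp (g := normalize ι (power ι u)) ?_
    (hasLipFDerivAt_predictor M Δt (embed_ne_zero_of_power_ne_zero hu) h hL hX)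
  rw [predictor_eq_self M Δt h]
  exact hasLipFDerivAt_normalize ι hu

end Step

end PCSOM

namespace PCSOM

section LinearizedOperator

variable {V H : Type*} [NormedAddCommGroup V] [NormedSpace ℝ V]
  [NormedAddCommGroup H] [InnerProductSpace ℝ H] {ι : V →L[ℝ] H} (M : AccelerationOperator V)
  {L00 : V → StrongDual ℝ V} {μ : ℝ} {u : V}

theorem embed_residualDeriv (x : V) : embed ι u (residualDeriv ι M L00 μ u x) = 0 :=
  embed_orthProj ι M u _

theorem residualDeriv_eq_zero {x : V} (hx : L1 ι L00 μ u x = 0) :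
    residualDeriv ι M L00 μ u x = 0 := by
  simp [residualDeriv, hx]

theorem embed_LPCfull (x : V) : embed ι u (LPCfull ι M L00 μ u x) = 0 :=
  LPCfull_mem ι M L00 μ u x

theorem stepDeriv_of_embed_eq_zero (Δt : ℝ) {x : V} (hx : embed ι u x = 0) :
    stepDeriv ι M L00 μ u Δt x = x + Δt • LPCfull ι M L00 μ u x :=
  radialProj_of_embed_eq_zero (by simp [hx, embed_LPCfull])

/-- In other words, `𝓛_PC = -R*R` with respect to the form of `M`, where `R` is the linearization
of the residual. -/
theorem op_LPCfull (x : V) {y : V} (hy : embed ι u y = 0) : M.op (LPCfull ι M L00 μ u x) y =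
    -M.op (residualDeriv ι M L00 μ u x) (residualDeriv ι M L00 μ u y) := by
  set R := residualDeriv ι M L00 μ u with hR
  have hleft : M.op (LPCfull ι M L00 μ u x) y = -L1 ι L00 μ u y (R x) := by
    simp only [LPCfull_eq, ← hR, _root_.neg_apply, ContinuousLinearMap.comp_apply, map_neg,
      op_orthProj_apply, orthProj_of_embed_eq_zero M hy, op_Minv]
    rfl
  have hright : M.op (R y) (R x) = L1 ι L00 μ u y (R x) := by
    calc M.op (R y) (R x) = M.op (Minv M (L1 ι L00 μ u y)) (orthProj ι M u (R x)) :=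
          op_orthProj_apply ι M u _ _
      _ = L1 ι L00 μ u y (R x) := by
          rw [orthProj_of_embed_eq_zero M (embed_residualDeriv M x), op_Minv]
  rw [hleft, M.hermitian, hright]

theorem op_LPCfull_self_nonpos {x : V} (hx : embed ι u x = 0) :
    M.op (LPCfull ι M L00 μ u x) x ≤ 0 := by
  rw [op_LPCfull M x hx, neg_nonpos]
  exact M.op_self_nonneg _

variable (ι u) in
/-- The form of `M` on `S`. -/
noncomputable def orthForm : orthSpace ι u →L[ℝ] StrongDual ℝ (orthSpace ι u) :=
  (M.op : V →L[ℝ] StrongDual ℝ V).bilinearComp (orthSpace ι u).subtypeL (orthSpace ι u).subtypeL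

theorem isCoercive_orthForm : IsCoercive (orthForm ι M u) := by
  obtain ⟨c, hc, h⟩ := M.isCoercive
  exact ⟨c, hc, fun x => h x⟩

theorem surjective_orthForm : Function.Surjective (orthForm ι M u) := by
  intro f
  obtain ⟨g, hg, -⟩ := exists_extension_norm_eq (orthSpace ι u) f
  refine ⟨⟨orthProj ι M u (Minv M g), embed_orthProj ι M u _⟩, ?_⟩
  ext x
  change M.op (orthProj ι M u (Minv M g)) x = f x
  rw [op_orthProj_apply, orthProj_of_embed_eq_zero M x.2, op_Minv, hg]

theorem orthForm_LPC (x y : orthSpace ι u) :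
    orthForm ι M u (LPC ι M L00 μ u x) y = orthForm ι M u x (LPC ι M L00 μ u y) := by
  change M.op (LPCfull ι M L00 μ u x) y = M.op x (LPCfull ι M L00 μ u y)
  rw [op_LPCfull M _ y.2, M.hermitian (x : V), op_LPCfull M _ x.2, M.hermitian]

variable (ι u) in
theorem isClosed_orthSpace : IsClosed (orthSpace ι u : Set V) := (embed ι u).isClosed_ker

theorem exists_norm_LPCfull_sub_smul_le {lam : ℝ} (h : lam ∈ spectrum ℝ (LPC ι M L00 μ u))
    {η : ℝ} (hη : 0 < η) :
    ∃ x ≠ 0, embed ι u x = 0 ∧ ‖LPCfull ι M L00 μ u x - lam • x‖ ≤ η * ‖x‖ := by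
  have := M.completeSpace
  have : CompleteSpace (orthSpace ι u) := (isClosed_orthSpace ι u).completeSpace_coe
  obtain ⟨x, hx, hxe⟩ := exists_norm_sub_smul_le_of_mem_spectrum (isCoercive_orthForm M)
    (surjective_orthForm M) (orthForm_LPC M) h hη
  exact ⟨x, by simpa using hx, x.2, hxe⟩

theorem exists_mul_norm_le_LPCfull_sub_smul {lam : ℝ}
    (h : lam ∉ spectrum ℝ (LPC ι M L00 μ u)) :
    ∃ c > 0, ∀ x, embed ι u x = 0 → c * ‖x‖ ≤ ‖LPCfull ι M L00 μ u x - lam • x‖ := by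
  obtain ⟨c, hc, hb⟩ := exists_forall_mul_norm_le_of_notMem_spectrum h
  exact ⟨c, hc, fun x hx => hb ⟨x, hx⟩⟩

variable {lam : ℝ} (h : IsLeast (spectrum ℝ (LPC ι M L00 μ u)) lam)
include h

theorem mul_op_self_le_op_LPCfull {x : V} (hx : embed ι u x = 0) :
    lam * M.op x x ≤ M.op (LPCfull ι M L00 μ u x) x :=
  mul_apply_self_le_of_isLeast_spectrum (isCoercive_orthForm M) (fun x y => M.hermitian x y)
    (orthForm_LPC M) h ⟨x, hx⟩

theorem nonpos_of_isLeast_spectrum_LPC : lam ≤ 0 := by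
  obtain ⟨x, hx, hxs, -⟩ := exists_norm_LPCfull_sub_smul_le M h.1 one_pos
  have hle := (mul_op_self_le_op_LPCfull M h hxs).trans (op_LPCfull_self_nonpos M hxs)
  exact nonpos_of_mul_nonpos_left hle (M.posDef x hx)

/-- Since `𝓛_PC = -R*R` is bounded below by `lam`, one has `‖R* R x‖² ≤ -lam ‖R x‖²`. -/
theorem op_LPCfull_LPCfull_le (x : V) :
    M.op (LPCfull ι M L00 μ u x) (LPCfull ι M L00 μ u x) ≤
      -lam * M.op (residualDeriv ι M L00 μ u x) (residualDeriv ι M L00 μ u x) := by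
  set G := LPCfull ι M L00 μ u
  set R := residualDeriv ι M L00 μ u
  have hS : embed ι u (G x) = 0 := embed_LPCfull M x
  have hGx : M.op (G x) (G x) = -M.op (R x) (R (G x)) := op_LPCfull M x hS
  have hRG : M.op (R (G x)) (R (G x)) ≤ -lam * M.op (G x) (G x) := by
    have hle : lam * M.op (G x) (G x) ≤ M.op (G (G x)) (G x) := mul_op_self_le_op_LPCfull M h hS
    have heq : M.op (G (G x)) (G x) = -M.op (R (G x)) (R (G x)) := op_LPCfull M (G x) hS
    linarith
  rcases (M.op_self_nonneg (G x)).eq_or_lt with h0 | h0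
  · rw [← h0]
    exact mul_nonneg (neg_nonneg.2 (nonpos_of_isLeast_spectrum_LPC M h)) (M.op_self_nonneg _)
  · refine le_of_mul_le_mul_right ?_ h0
    calc M.op (G x) (G x) * M.op (G x) (G x) = M.op (R x) (R (G x)) ^ 2 := by rw [hGx]; ring
      _ ≤ M.op (R x) (R x) * M.op (R (G x)) (R (G x)) := M.op_sq_le _ _
      _ ≤ M.op (R x) (R x) * (-lam * M.op (G x) (G x)) :=
          mul_le_mul_of_nonneg_left hRG (M.op_self_nonneg _)
      _ = -lam * M.op (R x) (R x) * M.op (G x) (G x) := by ring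

theorem op_add_smul_LPCfull_le {x : V} (hx : embed ι u x = 0) (t : ℝ) :
    M.op (x + t • LPCfull ι M L00 μ u x) (x + t • LPCfull ι M L00 μ u x) ≤
      M.op x x - t * (2 + t * lam) *
        M.op (residualDeriv ι M L00 μ u x) (residualDeriv ι M L00 μ u x) := by
  have hsq := mul_le_mul_of_nonneg_left (op_LPCfull_LPCfull_le M h x) (sq_nonneg t)
  simp only [map_add, map_smul, _root_.add_apply, _root_.smul_apply, smul_eq_mul]
  rw [M.hermitian x (LPCfull ι M L00 μ u x), op_LPCfull M x hx]
  linarith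

end LinearizedOperator

end PCSOM

/-! ### The family of solutions -/

theorem surjective_prod_of_le_range {𝕜 E F : Type*} [Field 𝕜] [AddCommGroup E] [Module 𝕜 E]
    [AddCommGroup F] [Module 𝕜 F] (D : E →ₗ[𝕜] F) (l : F →ₗ[𝕜] 𝕜) {K : Submodule 𝕜 F}
    (π : F →ₗ[𝕜] K) (hπ : ∀ x : K, π x = x) (hK : K ≤ D.range) (hlK : ∀ x ∈ K, l x = 0)
    {e : E} (he : l (D e) ≠ 0) : Function.Surjective fun e => (l (D e), π (D e)) := by
  rintro ⟨a, k⟩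
  have ha : l (D ((a / l (D e)) • e)) = a := by simp [he]
  set e₁ := (a / l (D e)) • e
  obtain ⟨e₂, he₂⟩ := hK (k - π (D e₁)).2
  refine ⟨e₁ + e₂, Prod.ext ?_ ?_⟩
  · simp only [map_add, ha, he₂, hlK _ (Subtype.mem _), add_zero]
  · simp only [map_add, he₂, hπ, add_sub_cancel]

namespace PCSOM

variable {V H : Type*} [NormedAddCommGroup V] [NormedSpace ℝ V]
  [NormedAddCommGroup H] [InnerProductSpace ℝ H] {ι : V →L[ℝ] H}

theorem power_ne_zero_of_deriv_power_ne_zero {γ : ℝ → V} {t : ℝ}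
    (h : deriv (fun x => power ι (γ x)) t ≠ 0) : power ι (γ t) ≠ 0 := fun h0 =>
  h (IsLocalMin.deriv_eq_zero (.of_forall fun x => h0.trans_le (power_nonneg ι (γ x))))

/-- The derivative of a family of solutions at `(μ, c₀)`, with respect to the propagation constant
and the free parameters together. -/
noncomputable def familyDeriv (U : ℝ → (Fin s → ℝ) → V) (μ : ℝ) (c₀ : Fin s → ℝ) :
    ℝ × (Fin s → ℝ) →L[ℝ] V :=
  fderiv ℝ (fun p : ℝ × (Fin s → ℝ) => U p.1 p.2) (μ, c₀)

namespace IsSolutionFamily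

variable {L00 : V → StrongDual ℝ V} {s : ℕ} {U : ℝ → (Fin s → ℝ) → V} {μ : ℝ} {c₀ : Fin s → ℝ}

theorem hasStrictFDerivAt (hU : IsSolutionFamily ι L00 U μ c₀) :
    HasStrictFDerivAt (fun p : ℝ × (Fin s → ℝ) => U p.1 p.2) (familyDeriv U μ c₀) (μ, c₀) :=
  hU.1.hasStrictFDerivAt one_ne_zero

theorem familyDeriv_single (hU : IsSolutionFamily ι L00 U μ c₀) (j : Fin s) :
    familyDeriv U μ c₀ (0, Pi.single j 1) = invarianceMode U μ c₀ j := by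
  have h : HasFDerivAt (U μ) (familyDeriv U μ c₀ ∘L .inr ℝ ℝ (Fin s → ℝ)) c₀ :=
    hU.hasStrictFDerivAt.hasFDerivAt.comp (f := fun c => (μ, c)) c₀ (hasFDerivAt_prodMk_right μ c₀)
  rw [invarianceMode, h.differentiableAt.lineDeriv_eq_fderiv, h.fderiv]
  simp

theorem span_invarianceMode_le_range (hU : IsSolutionFamily ι L00 U μ c₀) :
    Submodule.span ℝ (Set.range (invarianceMode U μ c₀)) ≤
      (familyDeriv U μ c₀ : ℝ × (Fin s → ℝ) →ₗ[ℝ] V).range := by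
  rw [Submodule.span_le]
  rintro _ ⟨j, rfl⟩
  exact ⟨_, hU.familyDeriv_single j⟩

theorem L1_familyDeriv (hU : IsSolutionFamily ι L00 U μ c₀)
    (hd : DifferentiableAt ℝ L00 (U μ c₀)) :
    L1 ι L00 μ (U μ c₀) (familyDeriv U μ c₀ (1, 0)) = embed ι (U μ c₀) := by
  have hD := hU.hasStrictFDerivAt.hasFDerivAt
  have hL00 := hd.hasFDerivAt.comp (f := fun p : ℝ × (Fin s → ℝ) => U p.1 p.2) (μ, c₀) hD
  have hembed := (embed ι).hasFDerivAt.comp (f := fun p : ℝ × (Fin s → ℝ) => U p.1 p.2) (μ, c₀) hD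
  have hL0 := hL00.sub ((hasFDerivAt_fst (p := (μ, c₀))).smul hembed)
  have hzero := congrArg (· ((1, 0) : ℝ × (Fin s → ℝ)))
    ((hL0.congr_of_eventuallyEq (EventuallyEq.symm hU.2)).unique (hasFDerivAt_const 0 (μ, c₀)))
  simp only [_root_.sub_apply, ContinuousLinearMap.comp_apply,
    _root_.smul_apply, ContinuousLinearMap.smulRight_apply, ContinuousLinearMap.coe_fst',
    one_smul, _root_.zero_apply, ← sub_sub, sub_eq_zero] at hzero
  exact hzero

theorem deriv_power (hU : IsSolutionFamily ι L00 U μ c₀) :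
    deriv (fun m => power ι (U m c₀)) μ = 2 * embed ι (U μ c₀) (familyDeriv U μ c₀ (1, 0)) := by
  have hline : HasDerivAt (fun m : ℝ => (m, c₀)) (1, 0) μ :=
    (hasDerivAt_id μ).prodMk (hasDerivAt_const μ c₀)
  have hU' : HasDerivAt (fun m => U m c₀) (familyDeriv U μ c₀ (1, 0)) μ :=
    hU.hasStrictFDerivAt.hasFDerivAt.comp_hasDerivAt (f := fun m : ℝ => (m, c₀)) μ hline
  exact ((hasFDerivAt_power ι (U μ c₀)).comp_hasDerivAt μ hU').deriv

theorem eventually_exists_power_eq (hU : IsSolutionFamily ι L00 U μ c₀)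
    (hP' : deriv (fun m => power ι (U m c₀)) μ ≠ 0) {K : Submodule ℝ V}
    (hK : K = Submodule.span ℝ (Set.range (invarianceMode U μ c₀)))
    (horth : ∀ x ∈ K, embed ι (U μ c₀) x = 0) (π : V →L[ℝ] K) (hπ : ∀ x : K, π x = x)
    {p : ℝ × (Fin s → ℝ) → Prop} (hp : ∀ᶠ q in 𝓝 (μ, c₀), p q) :
    ∀ᶠ v in 𝓝 (U μ c₀), ∃ q, p q ∧ power ι (U q.1 q.2) = power ι (U μ c₀) ∧
      π (v - U q.1 q.2) = 0 := by
  have : FiniteDimensional ℝ K := hK ▸ FiniteDimensional.span_of_finite ℝ (Set.finite_range _)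
  have : CompleteSpace K := FiniteDimensional.complete ℝ K
  have hpow : HasStrictFDerivAt (power ι) ((2 : ℝ) • embed ι (U μ c₀)) (U μ c₀) :=
    (contDiff_power ι).contDiffAt.hasStrictFDerivAt' (hasFDerivAt_power ι _) one_ne_zero
  have hΦ := (hpow.prodMk π.hasStrictFDerivAt).comp (μ, c₀) hU.hasStrictFDerivAt
  have hsurj := surjective_prod_of_le_range (familyDeriv U μ c₀ : ℝ × (Fin s → ℝ) →ₗ[ℝ] V)
    (((2 : ℝ) • embed ι (U μ c₀) : StrongDual ℝ V) : V →ₗ[ℝ] ℝ) (π : V →ₗ[ℝ] K) hπ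
    (hK.trans_le hU.span_invarianceMode_le_range) (fun x hx => by simp [horth x hx])
    (e := (1, 0)) (by simpa [hU.deriv_power] using hP')
  have himg := image_mem_map (m := fun q => (power ι (U q.1 q.2), π (U q.1 q.2))) hp
  rw [hΦ.map_nhds_eq_of_surj (LinearMap.range_eq_top.2 hsurj)] at himg
  have hlim : Tendsto (fun v : V => (power ι (U μ c₀), π v)) (𝓝 (U μ c₀))
      (𝓝 (power ι (U μ c₀), π (U μ c₀))) :=
    tendsto_const_nhds.prodMk_nhds (π.continuous.tendsto _)
  filter_upwards [hlim himg] with v ⟨q, hq, hqv⟩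
  obtain ⟨hpower, hmodes⟩ := Prod.mk_inj.1 hqv
  exact ⟨q, hq, hpower, by rw [map_sub, hmodes, sub_self]⟩

end IsSolutionFamily

end PCSOM

/-! ### Convergence -/

section Contraction

variable {V : Type*} [NormedAddCommGroup V] [NormedSpace ℝ V] {p : Seminorm ℝ V} {c ρ : ℝ}

theorem norm_sub_lt_and_seminorm_sub_le_of_contracting_increments (hc : 0 < c)
    (hlow : ∀ x, c * ‖x‖ ≤ p x) (hρ0 : 0 ≤ ρ) (hρ1 : ρ < 1) {x : ℕ → V} {u : V} {a : ℝ}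
    (hstep : ∀ n, ‖x n - u‖ < a → p (x (n + 3) - x (n + 2)) ≤ ρ * p (x (n + 2) - x (n + 1)))
    (h0 : ‖x 0 - u‖ < a) (h1 : ‖x 1 - u‖ + p (x 2 - x 1) / (c * (1 - ρ)) < a) (n : ℕ) :
    ‖x n - u‖ < a ∧ p (x (n + 2) - x (n + 1)) ≤ ρ ^ n * p (x 2 - x 1) := by
  set d := p (x 2 - x 1)
  have hd : 0 ≤ d := apply_nonneg p _
  have hρ : 0 < 1 - ρ := sub_pos.2 hρ1
  suffices h : ‖x n - u‖ < a ∧ p (x (n + 2) - x (n + 1)) ≤ ρ ^ n * d ∧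
      p (x (n + 1) - x 1) * (1 - ρ) ≤ (1 - ρ ^ n) * d from ⟨h.1, h.2.1⟩
  induction n with
  | zero => exact ⟨h0, by simp [d], by simp⟩
  | succ n ih =>
    obtain ⟨hnear, hincr, hsum⟩ := ih
    refine ⟨?_, ?_, ?_⟩
    · have hdist : ‖x (n + 1) - x 1‖ ≤ d / (c * (1 - ρ)) := by
        rw [le_div_iff₀ (mul_pos hc hρ)]
        calc ‖x (n + 1) - x 1‖ * (c * (1 - ρ)) = c * ‖x (n + 1) - x 1‖ * (1 - ρ) := by ring
          _ ≤ p (x (n + 1) - x 1) * (1 - ρ) := by gcongr; exact hlow _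
          _ ≤ (1 - ρ ^ n) * d := hsum
          _ ≤ d := mul_le_of_le_one_left hd (sub_le_self 1 (pow_nonneg hρ0 n))
      linarith [norm_sub_le_norm_sub_add_norm_sub (x (n + 1)) (x 1) u]
    · calc p (x (n + 3) - x (n + 2)) ≤ ρ * p (x (n + 2) - x (n + 1)) := hstep n hnear
        _ ≤ ρ * (ρ ^ n * d) := by gcongr
        _ = ρ ^ (n + 1) * d := by ring
    · have htri : p (x (n + 2) - x 1) ≤ p (x (n + 2) - x (n + 1)) + p (x (n + 1) - x 1) := by
        simpa using map_add_le_add p (x (n + 2) - x (n + 1)) (x (n + 1) - x 1)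
      calc p (x (n + 2) - x 1) * (1 - ρ)
          ≤ (p (x (n + 2) - x (n + 1)) + p (x (n + 1) - x 1)) * (1 - ρ) := by gcongr
        _ ≤ ρ ^ n * d * (1 - ρ) + (1 - ρ ^ n) * d := by
            rw [add_mul]
            gcongr
        _ = (1 - ρ ^ (n + 1)) * d := by ring

theorem cauchySeq_of_seminorm_sub_le (hc : 0 < c) (hlow : ∀ x, c * ‖x‖ ≤ p x) (hρ1 : ρ < 1)
    {x : ℕ → V} {d : ℝ} (h : ∀ n, p (x (n + 1) - x n) ≤ ρ ^ n * d) : CauchySeq x := by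
  refine cauchySeq_of_le_geometric ρ (d / c) hρ1 fun n => ?_
  rw [dist_eq_norm, norm_sub_rev, div_mul_eq_mul_div, le_div_iff₀ hc, mul_comm, mul_comm d]
  exact (hlow _).trans (h n)

/-- Unlike for the Banach fixed-point theorem, the fixed points near `u` may form a continuum. -/
theorem eventually_exists_tendsto_iterate_of_contracting_increments [CompleteSpace V]
    (hp : Continuous p) (hc : 0 < c) (hlow : ∀ x, c * ‖x‖ ≤ p x) (hρ0 : 0 ≤ ρ) (hρ1 : ρ < 1)
    {F : V → V} {u : V} (hFu : F u = u) (hF : ∀ᶠ v in 𝓝 u, ContinuousAt F v)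
    (hcontr : ∀ᶠ v in 𝓝 u, p (F (F (F v)) - F (F v)) ≤ ρ * p (F (F v) - F v))
    {N : Set V} (hN : N ∈ 𝓝 u) :
    ∀ᶠ v in 𝓝 u, (∀ n, F^[n] v ∈ N) ∧ ∃ q ∈ N, Tendsto (fun n => F^[n] v) atTop (𝓝 q) ∧
      F q = q := by
  obtain ⟨a, ha, hball⟩ := Metric.nhds_basis_closedBall.eventually_iff.1
    ((hF.and hcontr).and hN)
  have hlim : Tendsto F (𝓝 u) (𝓝 u) := by simpa [ContinuousAt, hFu] using hF.self_of_nhds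
  have hdist : Tendsto (fun v => ‖v - u‖) (𝓝 u) (𝓝 0) :=
    tendsto_iff_norm_sub_tendsto_zero.1 tendsto_id
  have hstart : Tendsto (fun v => ‖F v - u‖ + p (F (F v) - F v) / (c * (1 - ρ))) (𝓝 u) (𝓝 0) := by
    have hincr : Tendsto (fun v => p (F (F v) - F v)) (𝓝 u) (𝓝 0) := by
      simpa [Function.comp_def] using (hp.tendsto _).comp ((hlim.comp hlim).sub hlim)
    simpa using (hdist.comp hlim).add (hincr.div_const (c * (1 - ρ)))
  filter_upwards [hdist.eventually_lt_const ha, hstart.eventually_lt_const ha] with v hv hv'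
  have key := norm_sub_lt_and_seminorm_sub_le_of_contracting_increments hc hlow hρ0 hρ1
    (x := fun n => F^[n] v) (fun n hn => by
      simpa only [Function.iterate_succ_apply'] using
        (hball (mem_closedBall_iff_norm.2 hn.le)).1.2) hv hv'
  have hmem : ∀ n, F^[n] v ∈ Metric.closedBall u a := fun n =>
    mem_closedBall_iff_norm.2 (key n).1.le
  obtain ⟨q, hq⟩ := cauchySeq_tendsto_of_complete
    (cauchySeq_of_seminorm_sub_le (x := fun n => F^[n + 1] v) hc hlow hρ1 fun n => (key n).2)
  replace hq : Tendsto (fun n => F^[n] v) atTop (𝓝 q) := (tendsto_add_atTop_iff_nat 1).1 hq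
  have hqmem : q ∈ Metric.closedBall u a :=
    Metric.isClosed_closedBall.mem_of_tendsto hq (.of_forall hmem)
  exact ⟨fun n => (hball (hmem n)).2, q, (hball hqmem).2, hq,
    isFixedPt_of_tendsto_iterate hq (hball hqmem).1.1⟩

end Contraction

theorem exists_norm_sub_proj_le_of_isClosed_range {𝕜 E F : Type*} [NontriviallyNormedField 𝕜]
    [NormedAddCommGroup E] [NormedSpace 𝕜 E] [CompleteSpace E]
    [NormedAddCommGroup F] [NormedSpace 𝕜 F] [CompleteSpace F] (A : E →L[𝕜] F)
    (hA : IsClosed (Set.range A)) (π : E →L[𝕜] LinearMap.ker (A : E →ₗ[𝕜] F))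
    (hπ : ∀ x : LinearMap.ker (A : E →ₗ[𝕜] F), π x = x) :
    ∃ C > 0, ∀ x, ‖x - π x‖ ≤ C * ‖A x‖ := by
  have : CompleteSpace (Set.range A) := hA.completeSpace_coe
  have : CompleteSpace (LinearMap.range (A : E →ₗ[𝕜] F)) := this
  obtain ⟨C, hC, h⟩ := (A.codRestrict (LinearMap.range (A : E →ₗ[𝕜] F))
    (fun x => ⟨x, rfl⟩)).exists_preimage_norm_le (by rintro ⟨_, x, rfl⟩; exact ⟨x, rfl⟩)
  refine ⟨(1 + ‖π‖) * C, by positivity, fun x => ?_⟩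
  obtain ⟨y, hy, hn⟩ := h ⟨A x, x, rfl⟩
  have hAy : A y = A x := congrArg Subtype.val hy
  have hproj : (π (x - y) : E) = x - y := congrArg Subtype.val (hπ ⟨x - y, by simp [hAy]⟩)
  have hxy : x - π x = y - π y := by
    rw [map_sub, AddSubgroupClass.coe_sub] at hproj
    rw [sub_eq_sub_iff_sub_eq_sub, hproj]
  calc ‖x - π x‖ = ‖y - π y‖ := by rw [hxy]
    _ ≤ ‖y‖ + ‖(π y : E)‖ := norm_sub_le _ _
    _ ≤ ‖y‖ + ‖π‖ * ‖y‖ := by gcongr; exact π.le_opNorm y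
    _ = (1 + ‖π‖) * ‖y‖ := by ring
    _ ≤ (1 + ‖π‖) * (C * ‖A x‖) := by gcongr; exact hn
    _ = (1 + ‖π‖) * C * ‖A x‖ := by ring

namespace AccelerationOperator

variable {V : Type*} [NormedAddCommGroup V] [NormedSpace ℝ V] (M : AccelerationOperator V)

theorem eventually_energyNorm_le {α : Type*} {l : Filter α} {f g : α → V} (h : f =o[l] g) {η : ℝ}
    (hη : 0 < η) : ∀ᶠ a in l, M.energyNorm (f a) ≤ η * M.energyNorm (g a) := by
  obtain ⟨c, hc, hlow⟩ := M.exists_le_energyNorm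
  obtain ⟨C, hC, hup⟩ := M.exists_energyNorm_le
  filter_upwards [h.bound (show 0 < c * η / C by positivity)] with a ha
  calc M.energyNorm (f a) ≤ C * ‖f a‖ := hup _
    _ ≤ C * (c * η / C * ‖g a‖) := by gcongr
    _ = η * (c * ‖g a‖) := by field_simp
    _ ≤ η * M.energyNorm (g a) := by gcongr; exact hlow _

theorem energyNorm_le_energyNorm_sub {x y : V} (h : M.op x y = 0) :
    M.energyNorm x ≤ M.energyNorm (x - y) := by
  have hmul : M.energyNorm x * M.energyNorm x ≤ M.energyNorm x * M.energyNorm (x - y) := by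
    calc M.energyNorm x * M.energyNorm x = M.op x (x - y) := by
          rw [← sq, M.energyNorm_sq, map_sub, h, sub_zero]
      _ ≤ M.energyNorm x * M.energyNorm (x - y) :=
          (le_abs_self _).trans (M.abs_op_le_energyNorm_mul _ _)
  rcases (apply_nonneg M.energyNorm x).eq_or_lt with h0 | h0
  · rw [← h0]
    exact apply_nonneg _ _
  · exact le_of_mul_le_mul_left hmul h0

end AccelerationOperator

namespace PCSOM

variable {V H : Type*} [NormedAddCommGroup V] [NormedSpace ℝ V]
  [NormedAddCommGroup H] [InnerProductSpace ℝ H] {ι : V →L[ℝ] H} (M : AccelerationOperator V)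
  {L00 : V → StrongDual ℝ V} {μ : ℝ} {u : V}

section Differences

theorem two_mul_embed_sub (u : V) {v w : V} (h : power ι v = power ι w) :
    2 * embed ι u (v - w) = embed ι (u - v + (u - w)) (v - w) := by
  have hvw : embed ι v w = embed ι w v := ip_comm ι v w
  simp only [power, ← embed_apply] at h
  simp only [map_sub, map_add, _root_.add_apply, _root_.sub_apply]
  linarith

variable {l : Filter (V × V)} (hl : l ≤ 𝓝 (u, u)) (hpow : ∀ᶠ p in l, power ι p.1 = power ι p.2)
include hl hpow

theorem isLittleO_embed_sub :
    (fun p : V × V => embed ι u (p.1 - p.2)) =o[l] fun p => p.1 - p.2 := by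
  have hlim : Tendsto (fun p : V × V => ‖embed ι (u - p.1 + (u - p.2))‖) l (𝓝 0) := by
    have hcont : Continuous fun p : V × V => ‖embed ι (u - p.1 + (u - p.2))‖ := by fun_prop
    simpa using (hcont.tendsto (u, u)).mono_left hl
  have hmul := ((Asymptotics.isLittleO_one_iff ℝ).2 hlim).mul_isBigO
    (Asymptotics.isBigO_refl (fun p : V × V => ‖p.1 - p.2‖) l)
  simp only [one_mul] at hmul
  refine (Asymptotics.IsBigO.of_bound 1 ?_).trans_isLittleO hmul.of_norm_right
  filter_upwards [hpow] with p hp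
  rw [one_mul, norm_mul, norm_norm, norm_norm]
  calc ‖embed ι u (p.1 - p.2)‖ ≤ ‖2 * embed ι u (p.1 - p.2)‖ := by
        rw [norm_mul, Real.norm_two]
        linarith [norm_nonneg (embed ι u (p.1 - p.2))]
    _ ≤ ‖embed ι (u - p.1 + (u - p.2))‖ * ‖p.1 - p.2‖ := by
        rw [two_mul_embed_sub u hp]
        exact ContinuousLinearMap.le_opNorm _ _

theorem isLittleO_sub_orthProj :
    (fun p : V × V => p.1 - p.2 - orthProj ι M u (p.1 - p.2)) =o[l]
      fun p => orthProj ι M u (p.1 - p.2) := by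
  have hlittle : (fun p : V × V => p.1 - p.2 - orthProj ι M u (p.1 - p.2)) =o[l]
      fun p => p.1 - p.2 := by
    refine ((ContinuousLinearMap.toSpanSingleton ℝ
      ((denom ι M u)⁻¹ • Minv M (embed ι u))).isBigO_comp _ _).trans_isLittleO
        (isLittleO_embed_sub hl hpow) |>.congr_left fun p => ?_
    rw [orthProj_apply, sub_sub_cancel, ContinuousLinearMap.toSpanSingleton_apply, smul_smul,
      mul_comm]
  exact hlittle.trans_isBigO (hlittle.right_isBigO_sub.congr_right fun p => sub_sub_cancel _ _)

theorem isLittleO_map_sub {F : V → V} {Δt : ℝ}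
    (hF : HasStrictFDerivAt F (stepDeriv ι M L00 μ u Δt) u) :
    (fun p : V × V => F p.1 - F p.2 - stepDeriv ι M L00 μ u Δt (orthProj ι M u (p.1 - p.2))) =o[l]
      fun p => orthProj ι M u (p.1 - p.2) := by
  have hproj := isLittleO_sub_orthProj M hl hpow
  have hF' := (hF.isLittleO.mono hl).trans_isBigO
    ((hproj.isBigO.add (Asymptotics.isBigO_refl _ l)).congr_left fun p => sub_add_cancel _ _)
  refine (hF'.add (((stepDeriv ι M L00 μ u Δt).isBigO_comp _ _).trans_isLittleO hproj)).congr_left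
    fun p => ?_
  rw [map_sub _ (p.1 - p.2)]
  abel

end Differences

section LinearBounds

variable {π : V →L[ℝ] LinearMap.ker (L1 ι L00 μ u : V →ₗ[ℝ] StrongDual ℝ V)}
  (horth : ∀ x ∈ LinearMap.ker (L1 ι L00 μ u : V →ₗ[ℝ] StrongDual ℝ V), embed ι u x = 0)

include horth in
/-- The solution `w` of `L₁ w = u` accounts for the multiplier `β`, which vanishes with the
residual since `⟨u, w⟩ ≠ 0`. -/
theorem exists_norm_sub_proj_le_residualDeriv {w : V} (hw : L1 ι L00 μ u w = embed ι u)
    (huw : embed ι u w ≠ 0) (hclosed : IsClosed (Set.range (L1 ι L00 μ u)))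
    (hπ : ∀ x : LinearMap.ker (L1 ι L00 μ u : V →ₗ[ℝ] StrongDual ℝ V), π x = x) :
    ∃ C > 0, ∀ y, embed ι u y = 0 → ‖y - π y‖ ≤ C * ‖residualDeriv ι M L00 μ u y‖ := by
  have := M.completeSpace
  obtain ⟨C, hC, hbound⟩ := exists_norm_sub_proj_le_of_isClosed_range (L1 ι L00 μ u) hclosed π hπ
  set R := residualDeriv ι M L00 μ u with hR
  set m := ‖(M.op : V →L[ℝ] StrongDual ℝ V)‖
  set a := ‖embed ι u‖ / |embed ι u w| * (C * m) with ha
  refine ⟨C * m + a * ‖w - π w‖ + 1, by positivity, fun y hy => ?_⟩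
  set β := (denom ι M u)⁻¹ * embed ι u (Minv M (L1 ι L00 μ u y))
  have hsplit : y - π y = y - β • w - π (y - β • w) + β • (w - π w) := by
    simp only [map_sub, map_smul, AddSubgroupClass.coe_sub, Submodule.coe_smul, smul_sub]
    abel
  have hx : ‖y - β • w - π (y - β • w)‖ ≤ C * m * ‖R y‖ := by
    have hLx : L1 ι L00 μ u (y - β • w) = M.op (R y) := by
      simp only [hR, residualDeriv, ContinuousLinearMap.comp_apply, orthProj_apply, map_sub,
        map_smul, op_Minv, hw]
      rfl
    calc ‖y - β • w - π (y - β • w)‖ ≤ C * ‖M.op (R y)‖ := hLx ▸ hbound _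
      _ ≤ C * (m * ‖R y‖) := by
          gcongr
          exact (M.op : V →L[ℝ] StrongDual ℝ V).le_opNorm _
      _ = C * m * ‖R y‖ := by ring
  have hβ : |β| ≤ a * ‖R y‖ := by
    have hembed : embed ι u (y - β • w - π (y - β • w)) = -(β * embed ι u w) := by
      rw [map_sub, horth _ (π (y - β • w)).2, map_sub, hy]
      simp
    rw [ha, div_mul_eq_mul_div, div_mul_eq_mul_div, le_div_iff₀ (abs_pos.2 huw), ← abs_mul,
      ← abs_neg, ← hembed, mul_assoc]
    exact ((embed ι u).le_opNorm _).trans (by gcongr)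
  calc ‖y - π y‖ ≤ ‖y - β • w - π (y - β • w)‖ + |β| * ‖w - π w‖ := by
        rw [hsplit]
        exact (norm_add_le _ _).trans_eq (by rw [norm_smul, Real.norm_eq_abs])
    _ ≤ C * m * ‖R y‖ + a * ‖R y‖ * ‖w - π w‖ := by gcongr
    _ ≤ (C * m + a * ‖w - π w‖ + 1) * ‖R y‖ := by linarith [norm_nonneg (R y)]

theorem exists_energyNorm_sub_proj_le_residualDeriv {C : ℝ} (hC : 0 < C)
    (h : ∀ y, embed ι u y = 0 → ‖y - π y‖ ≤ C * ‖residualDeriv ι M L00 μ u y‖) :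
    ∃ D > 0, ∀ y, embed ι u y = 0 →
      M.energyNorm (y - π y) ≤ D * M.energyNorm (residualDeriv ι M L00 μ u y) := by
  obtain ⟨c₁, hc₁, hlow⟩ := M.exists_le_energyNorm
  obtain ⟨c₂, hc₂, hup⟩ := M.exists_energyNorm_le
  refine ⟨c₂ * C / c₁, by positivity, fun y hy => ?_⟩
  calc M.energyNorm (y - π y) ≤ c₂ * (C * ‖residualDeriv ι M L00 μ u y‖) :=
        (hup _).trans (by gcongr; exact h y hy)
    _ = c₂ * C / c₁ * (c₁ * ‖residualDeriv ι M L00 μ u y‖) := by field_simp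
    _ ≤ _ := by gcongr; exact hlow _

variable {D : ℝ} (hD : 0 < D) (hDR : ∀ y, embed ι u y = 0 →
  M.energyNorm (y - π y) ≤ D * M.energyNorm (residualDeriv ι M L00 μ u y))
include horth hD hDR

theorem energyNorm_sub_proj_le_LPCfull {y : V} (hy : embed ι u y = 0) :
    M.energyNorm (y - π y) ≤ D * (D * M.energyNorm (LPCfull ι M L00 μ u y)) := by
  set R := residualDeriv ι M L00 μ u
  set G := LPCfull ι M L00 μ u
  refine (hDR y hy).trans (mul_le_mul_of_nonneg_left ?_ hD.le)
  rcases (apply_nonneg M.energyNorm (R y)).eq_or_lt with h0 | h0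
  · rw [← h0]
    exact mul_nonneg hD.le (apply_nonneg _ _)
  refine le_of_mul_le_mul_right ?_ h0
  have hπy : R (π y) = 0 := residualDeriv_eq_zero M (π y).2
  have hop : M.op (G y) (y - π y) = -M.op (R y) (R y) := by
    rw [op_LPCfull M y (by rw [map_sub, hy, horth _ (π y).2, sub_zero]), map_sub R, hπy, sub_zero]
  calc M.energyNorm (R y) * M.energyNorm (R y) = |M.op (G y) (y - π y)| := by
        rw [hop, abs_neg, abs_of_nonneg (M.op_self_nonneg _), ← M.energyNorm_sq, sq]
    _ ≤ M.energyNorm (G y) * M.energyNorm (y - π y) := M.abs_op_le_energyNorm_mul _ _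
    _ ≤ M.energyNorm (G y) * (D * M.energyNorm (R y)) :=
        mul_le_mul_of_nonneg_left (hDR y hy) (apply_nonneg _ _)
    _ = D * M.energyNorm (G y) * M.energyNorm (R y) := by ring

omit hD in
theorem energyNorm_LPCfull_le (x : V) : M.energyNorm (LPCfull ι M L00 μ u x) ≤
    D * M.energyNorm (residualDeriv ι M L00 μ u (LPCfull ι M L00 μ u x)) := by
  set z := LPCfull ι M L00 μ u x
  have hop : M.op z (π z) = 0 := by
    rw [op_LPCfull M x (horth _ (π z).2), residualDeriv_eq_zero M (π z).2, map_zero, neg_zero]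
  exact (M.energyNorm_le_energyNorm_sub hop).trans (hDR z (embed_LPCfull M x))

theorem exists_energyNorm_stepDeriv_le {lam : ℝ}
    (hlam : IsLeast (spectrum ℝ (LPC ι M L00 μ u)) lam) {Δt : ℝ} (hΔ0 : 0 < Δt)
    (hΔ : 0 < 2 + Δt * lam) :
    ∃ κ, 0 ≤ κ ∧ κ < 1 ∧ ∀ x, M.energyNorm (stepDeriv ι M L00 μ u Δt (LPCfull ι M L00 μ u x)) ≤
      κ * M.energyNorm (LPCfull ι M L00 μ u x) := by
  set s := Δt * (2 + Δt * lam)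
  have hs0 : 0 < s := mul_pos hΔ0 hΔ
  refine ⟨√(1 - s / D ^ 2), Real.sqrt_nonneg _, ?_, fun x => ?_⟩
  · rw [Real.sqrt_lt' one_pos, one_pow]
    exact sub_lt_self 1 (div_pos hs0 (pow_pos hD 2))
  set z := LPCfull ι M L00 μ u x
  set R := residualDeriv ι M L00 μ u
  have hz : embed ι u z = 0 := embed_LPCfull M x
  have hR : M.energyNorm z ^ 2 / D ^ 2 ≤ M.energyNorm (R z) ^ 2 := by
    rw [div_le_iff₀ (by positivity), mul_comm, ← mul_pow]
    exact pow_le_pow_left₀ (apply_nonneg _ _) (energyNorm_LPCfull_le M horth hDR x) 2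
  have hsq : M.energyNorm (stepDeriv ι M L00 μ u Δt z) ^ 2 ≤
      (1 - s / D ^ 2) * M.energyNorm z ^ 2 := by
    calc M.energyNorm (stepDeriv ι M L00 μ u Δt z) ^ 2
        ≤ M.energyNorm z ^ 2 - s * M.energyNorm (R z) ^ 2 := by
          rw [stepDeriv_of_embed_eq_zero M Δt hz, M.energyNorm_sq, M.energyNorm_sq,
            M.energyNorm_sq]
          exact op_add_smul_LPCfull_le M hlam hz Δt
      _ ≤ M.energyNorm z ^ 2 - s * (M.energyNorm z ^ 2 / D ^ 2) := by gcongr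
      _ = (1 - s / D ^ 2) * M.energyNorm z ^ 2 := by ring
  calc M.energyNorm (stepDeriv ι M L00 μ u Δt z) ≤ √((1 - s / D ^ 2) * M.energyNorm z ^ 2) :=
        Real.le_sqrt_of_sq_le hsq
    _ = √(1 - s / D ^ 2) * M.energyNorm z := by
        rw [Real.sqrt_mul' _ (sq_nonneg _), Real.sqrt_sq (apply_nonneg _ _)]

end LinearBounds

section Contraction

variable {π : V →L[ℝ] LinearMap.ker (L1 ι L00 μ u : V →ₗ[ℝ] StrongDual ℝ V)}
  (horth : ∀ x ∈ LinearMap.ker (L1 ι L00 μ u : V →ₗ[ℝ] StrongDual ℝ V), embed ι u x = 0)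
  {D : ℝ} (hD : 0 < D) (hDR : ∀ y, embed ι u y = 0 →
    M.energyNorm (y - π y) ≤ D * M.energyNorm (residualDeriv ι M L00 μ u y))
  {F : V → V} {Δt : ℝ} (hF : HasStrictFDerivAt F (stepDeriv ι M L00 μ u Δt) u) (hΔ0 : 0 < Δt)
  {l : Filter (V × V)} (hl : l ≤ 𝓝 (u, u)) (hpow : ∀ᶠ p in l, power ι p.1 = power ι p.2)
  (hπl : ∀ᶠ p in l, π (p.1 - p.2) = 0) (hfix : ∀ᶠ p in l, F p.2 = p.2)
include horth hD hDR hl hpow hπl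

theorem isBigO_orthProj_LPCfull : (fun p : V × V => orthProj ι M u (p.1 - p.2)) =O[l]
    fun p => LPCfull ι M L00 μ u (orthProj ι M u (p.1 - p.2)) := by
  have hπ : (fun p : V × V => (π (orthProj ι M u (p.1 - p.2)) : V)) =o[l]
      fun p => orthProj ι M u (p.1 - p.2) := by
    refine ((π.isBigO_comp _ _).trans_isLittleO
      (isLittleO_sub_orthProj M hl hpow)).norm_left.congr' ?_ .rfl |>.of_norm_left
    filter_upwards [hπl] with p hp
    rw [map_sub, hp, zero_sub, norm_neg, Submodule.coe_norm]
  obtain ⟨c₁, hc₁, hlow⟩ := M.exists_le_energyNorm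
  obtain ⟨c₂, -, hup⟩ := M.exists_energyNorm_le
  refine (hπ.right_isBigO_sub).trans (.of_bound (D * (D * c₂) / c₁) (.of_forall fun p => ?_))
  rw [div_mul_eq_mul_div, le_div_iff₀' hc₁]
  calc c₁ * ‖orthProj ι M u (p.1 - p.2) - π (orthProj ι M u (p.1 - p.2))‖
      ≤ D * (D * M.energyNorm (LPCfull ι M L00 μ u (orthProj ι M u (p.1 - p.2)))) :=
        (hlow _).trans (energyNorm_sub_proj_le_LPCfull M horth hD hDR (embed_orthProj ι M u _))
    _ ≤ D * (D * (c₂ * ‖LPCfull ι M L00 μ u (orthProj ι M u (p.1 - p.2))‖)) := by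
        gcongr
        exact hup _
    _ = D * (D * c₂) * ‖LPCfull ι M L00 μ u (orthProj ι M u (p.1 - p.2))‖ := by ring

include hΔ0

theorem isBigO_sub_smul_LPCfull : (fun p : V × V => p.1 - p.2) =O[l]
    fun p => Δt • LPCfull ι M L00 μ u (orthProj ι M u (p.1 - p.2)) := by
  have hsub : (fun p : V × V => p.1 - p.2) =O[l] fun p => orthProj ι M u (p.1 - p.2) :=
    ((isLittleO_sub_orthProj M hl hpow).isBigO.add (Asymptotics.isBigO_refl _ l)).congr_left
      fun p => sub_add_cancel _ _
  exact hsub.trans ((isBigO_orthProj_LPCfull M horth hD hDR hl hpow hπl).trans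
    ((Asymptotics.isBigO_const_smul_right hΔ0.ne').2 (Asymptotics.isBigO_refl _ l)))

include hF hfix

theorem isEquivalent_step_sub : Asymptotics.IsEquivalent l (fun p : V × V => F p.1 - p.1)
    fun p => Δt • LPCfull ι M L00 μ u (orthProj ι M u (p.1 - p.2)) := by
  have hy : (fun p : V × V => orthProj ι M u (p.1 - p.2)) =O[l]
      fun p => Δt • LPCfull ι M L00 μ u (orthProj ι M u (p.1 - p.2)) :=
    ((orthProj ι M u).isBigO_comp _ _).trans
      (isBigO_sub_smul_LPCfull M horth hD hDR hΔ0 hl hpow hπl)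
  refine (((isLittleO_map_sub M hl hpow hF).sub
    (isLittleO_sub_orthProj M hl hpow)).trans_isBigO hy).congr' ?_ .rfl
  filter_upwards [hfix] with p hp
  simp only [Pi.sub_apply]
  rw [stepDeriv_of_embed_eq_zero M Δt (embed_orthProj ι M u _), hp]
  abel

/-- Only directions transversal to the kernel of `L₁` matter: a fixed point near `u` is determined
by its component in the kernel. -/
theorem eventually_eq_of_map_eq : ∀ᶠ p in l, F p.1 = p.1 → p.1 = p.2 := by
  have hbig : (fun p : V × V => p.1 - p.2) =O[l] fun p => F p.1 - p.1 :=
    (isBigO_sub_smul_LPCfull M horth hD hDR hΔ0 hl hpow hπl).trans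
      (isEquivalent_step_sub M horth hD hDR hF hΔ0 hl hpow hπl hfix).isBigO_symm
  obtain ⟨C, hC⟩ := hbig.bound
  filter_upwards [hC] with p hp hFp
  simpa [hFp, sub_eq_zero] using hp

theorem eventually_energyNorm_step_sub_le (hu : F u = u) {κ : ℝ} (hκ0 : 0 ≤ κ) (hκ1 : κ < 1)
    (hκ : ∀ x, M.energyNorm (stepDeriv ι M L00 μ u Δt (LPCfull ι M L00 μ u x)) ≤
      κ * M.energyNorm (LPCfull ι M L00 μ u x)) :
    ∀ᶠ p in l, M.energyNorm (F (F p.1) - F p.1) ≤ (1 + κ) / 2 * M.energyNorm (F p.1 - p.1) := by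
  set T := stepDeriv ι M L00 μ u Δt
  set z := fun p : V × V => Δt • LPCfull ι M L00 μ u (orthProj ι M u (p.1 - p.2))
  have hequiv := isEquivalent_step_sub M horth hD hDR hF hΔ0 hl hpow hπl hfix
  have hz : (fun p : V × V => z p - (F p.1 - p.1)) =o[l] fun p => F p.1 - p.1 :=
    hequiv.symm.isLittleO
  have hlim : Tendsto (fun p : V × V => (F p.1, p.1)) l (𝓝 (u, u)) := by
    have hFu : Tendsto F (𝓝 u) (𝓝 u) := by simpa [ContinuousAt, hu] using hF.continuousAt
    have hfst : Tendsto Prod.fst l (𝓝 u) := (continuous_fst.tendsto (u, u)).mono_left hl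
    exact (hFu.comp hfst).prodMk_nhds hfst
  have hT : (fun p : V × V => F (F p.1) - F p.1 - T (z p)) =o[l] fun p => F p.1 - p.1 := by
    refine ((hF.isLittleO.comp_tendsto hlim).sub
      ((T.isBigO_comp _ _).trans_isLittleO hz)).congr_left fun p => ?_
    simp only [Function.comp_apply, map_sub]
    abel
  have hη : 0 < (1 - κ) / 4 := by linarith
  filter_upwards [M.eventually_energyNorm_le hz hη, M.eventually_energyNorm_le hT hη] with p hzp hTp
  have hTz : M.energyNorm (T (z p)) ≤ κ * M.energyNorm (z p) := by
    simp only [z, map_smul, map_smul_eq_mul]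
    rw [mul_left_comm]
    gcongr
    exact hκ _
  have hsplit : F (F p.1) - F p.1 = F (F p.1) - F p.1 - T (z p) + T (z p) := by abel
  have hzd : M.energyNorm (z p) ≤ M.energyNorm (F p.1 - p.1) +
      M.energyNorm (z p - (F p.1 - p.1)) := by
    simpa using map_add_le_add M.energyNorm (F p.1 - p.1) (z p - (F p.1 - p.1))
  calc M.energyNorm (F (F p.1) - F p.1)
      ≤ M.energyNorm (F (F p.1) - F p.1 - T (z p)) + M.energyNorm (T (z p)) := by
        conv_lhs => rw [hsplit]
        exact map_add_le_add _ _ _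
    _ ≤ (1 - κ) / 4 * M.energyNorm (F p.1 - p.1) +
        κ * (M.energyNorm (F p.1 - p.1) + (1 - κ) / 4 * M.energyNorm (F p.1 - p.1)) := by
        gcongr
        exact hTz.trans (by gcongr; exact hzd.trans (by gcongr))
    _ ≤ (1 + κ) / 2 * M.energyNorm (F p.1 - p.1) := by
        nlinarith [mul_nonneg (mul_nonneg (sub_nonneg.2 hκ1.le) (sub_nonneg.2 hκ1.le))
          (apply_nonneg M.energyNorm (F p.1 - p.1))]

end Contraction

end PCSOM

namespace PCSOM

variable {V H : Type*} [NormedAddCommGroup V] [NormedSpace ℝ V]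
  [NormedAddCommGroup H] [InnerProductSpace ℝ H] {ι : V →L[ℝ] H} (M : AccelerationOperator V)
  {L00 : V → StrongDual ℝ V}

theorem eventually_power_step {μ : ℝ} {u : V} (Δt : ℝ) (hu : power ι u ≠ 0)
    (h : L0 ι L00 μ u = 0) (hL : HasLipFDerivAt L00 (fderiv ℝ L00 u) u)
    (hX : LipschitzNear (fderiv ℝ L00) u) :
    ∀ᶠ v in 𝓝 u, power ι (step ι M L00 (power ι u) Δt v) = power ι u := by
  have hpred : ContinuousAt (predictor ι M L00 Δt) u :=
    (hasLipFDerivAt_predictor M Δt (embed_ne_zero_of_power_ne_zero hu) h hL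
      hX).lipschitzNear.continuousAt
  have hne : ∀ᶠ v in 𝓝 u, power ι (predictor ι M L00 Δt v) ≠ 0 :=
    ((contDiff_power (n := 0) ι).continuous.continuousAt.comp hpred).eventually_ne
      (by simpa [predictor_eq_self M Δt h] using hu)
  filter_upwards [hne] with v hv
  exact power_normalize ι (power_nonneg ι u) hv

theorem tendsto_rayleigh {μ : ℝ} {u : V} (hu : power ι u ≠ 0) (h : L0 ι L00 μ u = 0)
    (hL : LipschitzNear L00 u) : Tendsto (rayleigh ι M L00) (𝓝 u) (𝓝 μ) := by
  have hu' := embed_ne_zero_of_power_ne_zero hu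
  exact rayleigh_eq M hu' h ▸ (lipschitzNear_rayleigh M hu' hL).continuousAt.tendsto

/-- Pairs `(v, q)` near `u` consisting of a state `v` and a stationary state `q` of the same power
whose difference has no component along the kernel of `L₁`: the setting in which the iteration of
`v` is compared with `q`. -/
def transversalPairs (ι : V →L[ℝ] H) (M : AccelerationOperator V) (L00 : V → StrongDual ℝ V)
    (u : V) (Δt : ℝ) {K : Submodule ℝ V} (π : V →L[ℝ] K) : Filter (V × V) :=
  𝓝 (u, u) ⊓ 𝓟 {p | power ι p.1 = power ι p.2 ∧ π (p.1 - p.2) = 0 ∧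
    step ι M L00 (power ι u) Δt p.2 = p.2}

theorem exists_eventually_contraction_transversalPairs {μ : ℝ} {u : V}
    {π : V →L[ℝ] LinearMap.ker (L1 ι L00 μ u : V →ₗ[ℝ] StrongDual ℝ V)}
    (hπ : ∀ x : LinearMap.ker (L1 ι L00 μ u : V →ₗ[ℝ] StrongDual ℝ V), π x = x)
    (horth : ∀ x, L1 ι L00 μ u x = 0 → embed ι u x = 0)
    {w : V} (hw : L1 ι L00 μ u w = embed ι u) (huw : embed ι u w ≠ 0)
    (hu : power ι u ≠ 0) (h : L0 ι L00 μ u = 0)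
    (hL : HasLipFDerivAt L00 (fderiv ℝ L00 u) u) (hX : LipschitzNear (fderiv ℝ L00) u)
    {lam : ℝ} (hlam : IsLeast (spectrum ℝ (LPC ι M L00 μ u)) lam)
    (hclosed : IsClosed (Set.range (L1 ι L00 μ u))) {Δt : ℝ} (hΔ0 : 0 < Δt)
    (hΔ : 0 < 2 + Δt * lam) :
    ∃ ρ, 0 ≤ ρ ∧ ρ < 1 ∧ ∀ᶠ p in transversalPairs ι M L00 u Δt π,
      M.energyNorm (step ι M L00 (power ι u) Δt (step ι M L00 (power ι u) Δt p.1) -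
        step ι M L00 (power ι u) Δt p.1) ≤
          ρ * M.energyNorm (step ι M L00 (power ι u) Δt p.1 - p.1) ∧
      (step ι M L00 (power ι u) Δt p.1 = p.1 → p.1 = p.2) := by
  obtain ⟨C, hC, hbelow⟩ := exists_norm_sub_proj_le_residualDeriv M horth hw huw hclosed hπ
  obtain ⟨D, hD, hDR⟩ := exists_energyNorm_sub_proj_le_residualDeriv M hC hbelow
  obtain ⟨κ, hκ0, hκ1, hκ⟩ := exists_energyNorm_stepDeriv_le M horth hD hDR hlam hΔ0 hΔ
  have hF := (hasLipFDerivAt_step M Δt hu h hL hX).hasStrictFDerivAt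
  have hl : transversalPairs ι M L00 u Δt π ≤ 𝓝 (u, u) := inf_le_left
  have hmem : ∀ᶠ p in transversalPairs ι M L00 u Δt π, power ι p.1 = power ι p.2 ∧
      π (p.1 - p.2) = 0 ∧ step ι M L00 (power ι u) Δt p.2 = p.2 :=
    mem_inf_of_right (mem_principal_self _)
  have hpow := hmem.mono fun p hp => hp.1
  have hπl := hmem.mono fun p hp => hp.2.1
  have hfix := hmem.mono fun p hp => hp.2.2
  exact ⟨(1 + κ) / 2, by linarith, by linarith,
    (eventually_energyNorm_step_sub_le M horth hD hDR hF hΔ0 hl hpow hπl hfix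
      (step_eq_self M Δt hu h) hκ0 hκ1 hκ).and
    (eventually_eq_of_map_eq M horth hD hDR hF hΔ0 hl hpow hπl hfix)⟩

section Family

variable {s : ℕ} {U : ℝ → (Fin s → ℝ) → V} {μ : ℝ} {c₀ : Fin s → ℝ}
  (hU : IsSolutionFamily ι L00 U μ c₀)
  (hker : LinearMap.ker (L1 ι L00 μ (U μ c₀) : V →ₗ[ℝ] StrongDual ℝ V) =
    Submodule.span ℝ (Set.range (invarianceMode U μ c₀)))
  (horth : ∀ x, L1 ι L00 μ (U μ c₀) x = 0 → embed ι (U μ c₀) x = 0)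
  (hP' : deriv (fun m => power ι (U m c₀)) μ ≠ 0)
include hU hker horth hP'

theorem IsSolutionFamily.eventually_exists_transversalPairs {Δt : ℝ}
    {π : V →L[ℝ] LinearMap.ker (L1 ι L00 μ (U μ c₀) : V →ₗ[ℝ] StrongDual ℝ V)}
    (hπ : ∀ x : LinearMap.ker (L1 ι L00 μ (U μ c₀) : V →ₗ[ℝ] StrongDual ℝ V), π x = x)
    {good : V × V → Prop} (hgood : ∀ᶠ p in transversalPairs ι M L00 (U μ c₀) Δt π, good p)
    {near : ℝ × (Fin s → ℝ) → Prop} (hnear : ∀ᶠ q in 𝓝 (μ, c₀), near q) :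
    ∀ᶠ v in 𝓝 (U μ c₀), power ι v = power ι (U μ c₀) → ∃ q : ℝ × (Fin s → ℝ),
      near q ∧ L0 ι L00 q.1 (U q.1 q.2) = 0 ∧ power ι (U q.1 q.2) = power ι (U μ c₀) ∧
        good (v, U q.1 q.2) := by
  rw [transversalPairs, eventually_inf_principal, nhds_prod_eq, eventually_prod_self_iff'] at hgood
  obtain ⟨W, hW, hgoodW⟩ := hgood
  have hUW : ∀ᶠ q : ℝ × (Fin s → ℝ) in 𝓝 (μ, c₀), U q.1 q.2 ∈ W :=
    hU.1.continuousAt.eventually hW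
  filter_upwards [hW, hU.eventually_exists_power_eq hP' hker horth π hπ
    ((hnear.and hU.2).and hUW)] with v hv ⟨q, ⟨⟨hq, hsol⟩, hqW⟩, hpow, hmodes⟩ hvpow
  refine ⟨q, hq, hsol, hpow, hgoodW v hv _ hqW ⟨hvpow.trans hpow.symm, hmodes, ?_⟩⟩
  have hfix := step_eq_self M Δt (hpow ▸ power_ne_zero_of_deriv_power_ne_zero hP') hsol
  rwa [hpow] at hfix

variable (hL : HasLipFDerivAt L00 (fderiv ℝ L00 (U μ c₀)) (U μ c₀))
  (hX : LipschitzNear (fderiv ℝ L00) (U μ c₀)) {lam : ℝ}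
  (hlam : IsLeast (spectrum ℝ (LPC ι M L00 μ (U μ c₀))) lam)
  (hclosed : IsClosed (Set.range (L1 ι L00 μ (U μ c₀)))) {Δt : ℝ} (hΔ0 : 0 < Δt)
  (hΔ : 0 < 2 + Δt * lam)
include hL hX hlam hclosed hΔ0 hΔ

theorem IsSolutionFamily.exists_eventually_contraction_and_fixedPoint :
    ∃ ρ, 0 ≤ ρ ∧ ρ < 1 ∧ ∀ near : ℝ × (Fin s → ℝ) → Prop, (∀ᶠ q in 𝓝 (μ, c₀), near q) →
      ∀ᶠ v in 𝓝 (U μ c₀), power ι v = power ι (U μ c₀) →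
        M.energyNorm (step ι M L00 (power ι (U μ c₀)) Δt
          (step ι M L00 (power ι (U μ c₀)) Δt v) - step ι M L00 (power ι (U μ c₀)) Δt v) ≤
            ρ * M.energyNorm (step ι M L00 (power ι (U μ c₀)) Δt v - v) ∧
        (step ι M L00 (power ι (U μ c₀)) Δt v = v → ∃ q : ℝ × (Fin s → ℝ), near q ∧
          L0 ι L00 q.1 (U q.1 q.2) = 0 ∧ power ι (U q.1 q.2) = power ι (U μ c₀) ∧
            v = U q.1 q.2) := by
  have : FiniteDimensional ℝ (LinearMap.ker (L1 ι L00 μ (U μ c₀) : V →ₗ[ℝ] StrongDual ℝ V)) :=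
    hker ▸ FiniteDimensional.span_of_finite ℝ (Set.finite_range _)
  obtain ⟨π, hπ⟩ := Submodule.ClosedComplemented.of_finiteDimensional (𝕜 := ℝ)
    (LinearMap.ker (L1 ι L00 μ (U μ c₀) : V →ₗ[ℝ] StrongDual ℝ V))
  have huw : embed ι (U μ c₀) (familyDeriv U μ c₀ (1, 0)) ≠ 0 := fun h =>
    hP' (by rw [hU.deriv_power, h, mul_zero])
  obtain ⟨ρ, hρ0, hρ1, hgood⟩ := exists_eventually_contraction_transversalPairs M hπ horth
    (hU.L1_familyDeriv hL.hasStrictFDerivAt.hasFDerivAt.differentiableAt) huw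
    (power_ne_zero_of_deriv_power_ne_zero hP') hU.2.self_of_nhds hL hX hlam hclosed hΔ0 hΔ
  refine ⟨ρ, hρ0, hρ1, fun near hnear => ?_⟩
  filter_upwards [hU.eventually_exists_transversalPairs M hker horth hP' hπ hgood hnear]
    with v hv hvpow
  obtain ⟨q, hq, hsol, hpow, hcontr, heq⟩ := hv hvpow
  exact ⟨hcontr, fun hfix => ⟨q, hq, hsol, hpow, heq hfix⟩⟩

theorem convergesNear : ConvergesNear ι M L00 U μ c₀ (power ι (U μ c₀)) Δt := by
  have := M.completeSpace
  set u := U μ c₀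
  have h0 : L0 ι L00 μ u = 0 := hU.2.self_of_nhds
  have hu : power ι u ≠ 0 := power_ne_zero_of_deriv_power_ne_zero hP'
  set F := step ι M L00 (power ι u) Δt
  have hF : LipschitzNear F u := (hasLipFDerivAt_step M Δt hu h0 hL hX).lipschitzNear
  have hFu : F u = u := step_eq_self M Δt hu h0
  have hpow : ∀ᶠ v in 𝓝 u, power ι (F v) = power ι u := eventually_power_step M Δt hu h0 hL hX
  obtain ⟨ρ, hρ0, hρ1, hsol⟩ := hU.exists_eventually_contraction_and_fixedPoint M hker horth hP'
    hL hX hlam hclosed hΔ0 hΔ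
  obtain ⟨c, hc, hlow⟩ := M.exists_le_energyNorm
  have hlim : Tendsto F (𝓝 u) (𝓝 u) := by simpa [ContinuousAt, hFu] using hF.continuousAt
  intro ε hε
  obtain ⟨δ, hδ, hconv⟩ := Metric.eventually_nhds_iff.1
    (eventually_exists_tendsto_iterate_of_contracting_increments M.continuous_energyNorm hc hlow
      hρ0 hρ1 hFu (hF.eventually_nhds.mono fun v hv => hv.continuousAt)
      ((hlim.eventually (hsol _ (.of_forall fun _ => trivial))).mp
        (hpow.mono fun v hv h => (h hv).1))
      (((hsol _ (Metric.ball_mem_nhds (μ, c₀) hε)).and hpow).and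
        (hL.lipschitzNear.eventually_nhds.and (Metric.ball_mem_nhds u hε))))
  refine ⟨δ, hδ, fun v hv => ?_⟩
  obtain ⟨hn, q, ⟨⟨hq, hqpow⟩, hqL, -⟩, hlimq, hFq⟩ := hconv (by rwa [dist_eq_norm])
  rw [hFq] at hqpow
  obtain ⟨⟨μ', c'⟩, hnear, hL0, hpowq, rfl⟩ := (hq hqpow).2 hFq
  obtain ⟨hμ, hc'⟩ := max_lt_iff.1 (Metric.mem_ball.1 hnear)
  exact ⟨fun n => mem_ball_iff_norm.1 (hn n).2.2, μ', c', by rwa [← Real.dist_eq],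
    by rwa [← dist_eq_norm], hL0, hpowq, hlimq,
    (tendsto_rayleigh M (hpowq ▸ hu) hL0 hqL).comp hlimq⟩

end Family

end PCSOM

/-! ### Divergence -/

section QuadraticRecursion

variable {E : Type*} [AddCommGroup E] [Module ℝ E] {p : Seminorm ℝ E} {T : E →ₗ[ℝ] E}
  {S : Submodule ℝ E} {r C : ℝ}

theorem seminorm_sub_smul_le_of_approx_eigenvector (hr : 0 ≤ r) (hC : 0 ≤ C)
    (hT : ∀ x ∈ S, p (T x) ≤ r * p x) {x z z' : E} {η a s : ℝ} (hxS : x ∈ S) (hx : p x = 1)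
    (hxT : p (T x + r • x) ≤ η) (hzS : z ∈ S) (ha : a ≤ 1)
    (hz : p (z - s • x) ≤ a * |s|) (hz' : p (z' - T z) ≤ C * p z ^ 2) :
    p (z' - (-r * s) • x) ≤ (4 * C * |s| + r * a + η) * |s| := by
  have hsx : p (s • x) = |s| := by rw [map_smul_eq_mul, hx, mul_one, Real.norm_eq_abs]
  have hpz : p z ≤ 2 * |s| := by
    calc p z = p (z - s • x + s • x) := by rw [sub_add_cancel]
      _ ≤ a * |s| + |s| := (map_add_le_add p _ _).trans (add_le_add hz hsx.le)
      _ ≤ 1 * |s| + |s| := by gcongr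
      _ = 2 * |s| := by ring
  have hdec : z' - (-r * s) • x = z' - T z + T (z - s • x) + s • (T x + r • x) := by
    rw [map_sub, map_smul]
    module
  calc p (z' - (-r * s) • x)
      ≤ p (z' - T z) + p (T (z - s • x)) + p (s • (T x + r • x)) := by
        rw [hdec]
        exact (map_add_le_add p _ _).trans (add_le_add_left (map_add_le_add p _ _) _)
    _ ≤ C * (2 * |s|) ^ 2 + r * (a * |s|) + |s| * η := by
        gcongr
        · exact hz'.trans (by gcongr)
        · exact (hT _ (S.sub_mem hzS (S.smul_mem s hxS))).trans (by gcongr)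
        · rw [map_smul_eq_mul, Real.norm_eq_abs]
          gcongr
    _ = (4 * C * |s| + r * a + η) * |s| := by ring

variable (hr : 1 < r) (hC : 0 ≤ C) (hT : ∀ x ∈ S, p (T x) ≤ r * p x)
include hr hC hT

/-- The relative error `D δ rᵏ + k η` collects the quadratic terms, which sum to a geometric
progression, and the defect `η` of the approximate eigenvector at each step. -/
theorem seminorm_sub_pow_smul_le_of_approx_eigenvector {D δ η : ℝ} (hCD : C ≤ D)
    (hD : 4 * C ≤ D * (r - 1)) (hδ : 0 ≤ δ) (hη : 0 ≤ η) {N : ℕ}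
    (hN : D * δ * r ^ N + N * η ≤ 1) {x : E} (hxS : x ∈ S) (hx : p x = 1)
    (hxT : p (T x + r • x) ≤ η) {z : ℕ → E} (hzS : ∀ k, z k ∈ S)
    (hz0 : p (z 0 - δ • x) ≤ C * δ ^ 2) (hz : ∀ k, p (z (k + 1) - T (z k)) ≤ C * p (z k) ^ 2) :
    ∀ k ≤ N, p (z k - ((-r) ^ k * δ) • x) ≤ (D * δ * r ^ k + k * η) * (δ * r ^ k) := by
  have hr0 : 0 ≤ r := by linarith
  have hD0 : 0 ≤ D := hC.trans hCD
  have habs (k : ℕ) : |(-r) ^ k * δ| = δ * r ^ k := by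
    rw [abs_mul, abs_pow, abs_neg, abs_of_nonneg hr0, abs_of_nonneg hδ, mul_comm]
  intro k
  induction k with
  | zero =>
    intro _
    calc p (z 0 - ((-r) ^ 0 * δ) • x) ≤ C * δ ^ 2 := by simpa using hz0
      _ ≤ D * δ ^ 2 := by gcongr
      _ = (D * δ * r ^ 0 + (0 : ℕ) * η) * (δ * r ^ 0) := by push_cast; ring
  | succ k ih =>
    intro hk
    have hk' : k ≤ N := by omega
    have ha : D * δ * r ^ k + k * η ≤ 1 := le_trans (by gcongr; exact hr.le) hN
    have hstep := seminorm_sub_smul_le_of_approx_eigenvector hr0 hC hT hxS hx hxT (hzS k) ha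
      (by rw [habs]; exact ih hk') (hz k)
    rw [habs, ← mul_assoc, ← pow_succ'] at hstep
    refine hstep.trans ?_
    have hquad : 4 * C * (δ * r ^ k) ≤ D * (r - 1) * r * (δ * r ^ k) := by
      refine mul_le_mul_of_nonneg_right ?_ (by positivity)
      exact hD.trans (le_mul_of_one_le_right ((mul_nonneg four_pos.le hC).trans hD) hr.le)
    have hdefect : η ≤ η * r := le_mul_of_one_le_right hη hr.le
    calc (4 * C * (δ * r ^ k) + r * (D * δ * r ^ k + k * η) + η) * (δ * r ^ k)
        ≤ (D * (r - 1) * r * (δ * r ^ k) + r * (D * δ * r ^ k + k * η) + η * r) *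
            (δ * r ^ k) := by gcongr
      _ = (D * δ * r ^ (k + 1) + (k + 1 : ℕ) * η) * (δ * r ^ (k + 1)) := by
        push_cast
        ring

/-- If `T` has approximate eigenvectors for `-r`, where `r > 1` bounds `T` on `S`, a sequence that
follows `T` up to quadratic errors and starts at a small multiple of one of them grows to a size
that is independent of the start: the approximate eigenvector is chosen for the time `N` that the
growth takes. -/
theorem exists_eventually_exists_le_seminorm
    (happrox : ∀ η > 0, ∃ x ∈ S, p x = 1 ∧ p (T x + r • x) ≤ η) :
    ∃ ρ > 0, ∀ᶠ δ in 𝓝[>] (0 : ℝ), ∃ x ∈ S, p x = 1 ∧ ∀ z : ℕ → E, (∀ k, z k ∈ S) →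
      p (z 0 - δ • x) ≤ C * δ ^ 2 → (∀ k, p (z (k + 1) - T (z k)) ≤ C * p (z k) ^ 2) →
      ∃ N, ρ ≤ p (z N) := by
  have hr0 : 0 < r - 1 := by linarith
  obtain ⟨D, hD0, hCD, hD⟩ : ∃ D > 0, C ≤ D ∧ 4 * C ≤ D * (r - 1) := by
    refine ⟨C + 1 + 4 * C / (r - 1), by positivity, ?_, ?_⟩
    · linarith [show 0 ≤ 4 * C / (r - 1) by positivity]
    · rw [add_mul, div_mul_cancel₀ _ hr0.ne']
      linarith [show 0 ≤ (C + 1) * (r - 1) by positivity]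
  refine ⟨1 / (8 * D * r), by positivity, ?_⟩
  filter_upwards [Ioo_mem_nhdsGT (show 0 < 1 / (4 * D) by positivity)] with δ ⟨hδ0, hδ⟩
  have hδD : 1 ≤ 1 / (4 * D * δ) := by
    rw [lt_div_iff₀ (by positivity)] at hδ
    rw [le_div_iff₀ (by positivity)]
    linarith
  obtain ⟨N, hN, hN'⟩ := exists_nat_pow_near hδD hr
  rw [le_div_iff₀ (by positivity)] at hN
  rw [div_lt_iff₀ (by positivity)] at hN'
  obtain ⟨x, hxS, hx, hxT⟩ := happrox (1 / (4 * (N + 1))) (by positivity)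
  refine ⟨x, hxS, hx, fun z hzS hz0 hz => ⟨N, ?_⟩⟩
  have hNη : N * (1 / (4 * (N + 1) : ℝ)) ≤ 1 / 4 := by
    rw [mul_one_div, div_le_div_iff₀ (by positivity) (by norm_num)]
    linarith
  have hsize : D * δ * r ^ N + N * (1 / (4 * (N + 1))) ≤ 1 / 2 := by linarith
  have herr := seminorm_sub_pow_smul_le_of_approx_eigenvector hr hC hT hCD hD hδ0.le
    (by positivity) (hsize.trans (by norm_num)) hxS hx hxT hzS hz0 hz N le_rfl
  have hmain : p (((-r) ^ N * δ) • x) = δ * r ^ N := by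
    rw [map_smul_eq_mul, hx, norm_mul, norm_pow, norm_neg, Real.norm_of_nonneg (by linarith),
      Real.norm_of_nonneg hδ0.le, mul_one, mul_comm]
  have hhalf : δ * r ^ N / 2 ≤ p (z N) := by
    have htri := map_sub_le_add p (z N) (z N - ((-r) ^ N * δ) • x)
    rw [sub_sub_cancel, hmain] at htri
    have := mul_le_mul_of_nonneg_right hsize (show 0 ≤ δ * r ^ N by positivity)
    linarith
  refine le_trans ?_ hhalf
  rw [div_le_iff₀ (by positivity)]
  linarith [show δ * r ^ N / 2 * (8 * D * r) = r ^ (N + 1) * (4 * D * δ) by ring]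

end QuadraticRecursion

section QuadraticForm

variable {V : Type*} [NormedAddCommGroup V] [NormedSpace ℝ V] (b : V →L[ℝ] StrongDual ℝ V)

theorem isLittleO_apply_self_sub {α : Type*} {l : Filter α} {f g k : α → V}
    (hfg : (fun a => f a - g a) =o[l] k) (hg : g =O[l] k) :
    (fun a => b (f a) (f a) - b (g a) (g a)) =o[l] fun a => ‖k a‖ ^ 2 := by
  have hb {f₁ f₂ : α → V} : (fun a => b (f₁ a) (f₂ a)) =O[l] fun a => ‖f₁ a‖ * ‖f₂ a‖ :=
    .of_bound ‖b‖ (.of_forall fun a => by simpa [mul_assoc] using b.le_opNorm₂ (f₁ a) (f₂ a))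
  have hf : f =O[l] k := (hfg.isBigO.add hg).congr_left fun a => sub_add_cancel _ _
  refine ((hb.trans_isLittleO (hfg.norm_norm.mul_isBigO hf.norm_norm)).add
    (hb.trans_isLittleO (hg.norm_norm.mul_isLittleO hfg.norm_norm))).congr (fun a => ?_)
      fun a => (sq _).symm
  simp only [map_sub, _root_.sub_apply]
  ring

theorem eventually_apply_sub_self_pos {f : V → V} {f' : V →L[ℝ] V} {v x : V}
    (hf : HasFDerivAt f f' v) (hx : 0 < b (f' x) (f' x)) :
    ∀ᶠ t in 𝓝[≠] (0 : ℝ), 0 < b (f (v + t • x) - f v) (f (v + t • x) - f v) := by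
  have hcont : Continuous fun y => b y y := by fun_prop
  filter_upwards [((hcont.tendsto _).comp (hf.hasLineDerivAt x).tendsto_slope_zero).eventually
    (lt_mem_nhds hx)] with t ht
  have : 0 < t⁻¹ ^ 2 * b (f (v + t • x) - f v) (f (v + t • x) - f v) := by
    simpa [sq, mul_assoc] using ht
  exact pos_of_mul_pos_right this (sq_nonneg _)

theorem exists_lt_norm_of_expanding {τ : ℝ} (hτ : 1 < τ) {x : ℕ → V} (hx0 : 0 < b (x 0) (x 0))
    (hx : ∀ n, τ * b (x n) (x n) ≤ b (x (n + 1)) (x (n + 1))) (R : ℝ) : ∃ n, R < ‖x n‖ := by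
  have hgrow (n : ℕ) : τ ^ n * b (x 0) (x 0) ≤ b (x n) (x n) := by
    induction n with
    | zero => simp
    | succ n ih =>
      rw [pow_succ', mul_assoc]
      exact le_trans (by gcongr) (hx n)
  by_contra! hR
  obtain ⟨n, hn⟩ := pow_unbounded_of_one_lt (‖b‖ * R ^ 2 / b (x 0) (x 0)) hτ
  rw [div_lt_iff₀ hx0] at hn
  have hbound : b (x n) (x n) ≤ ‖b‖ * R ^ 2 :=
    (apply_self_le_opNorm_mul_sq b _).trans (by gcongr; exact hR n)
  linarith [hgrow n]

end QuadraticForm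

namespace AccelerationOperator

variable {V : Type*} [NormedAddCommGroup V] [NormedSpace ℝ V] (M : AccelerationOperator V)

theorem exists_eventually_energyNorm_le_mul_sq {α : Type*} {l : Filter α} {f g : α → V}
    (h : f =O[l] fun a => ‖g a‖ ^ 2) :
    ∃ C > 0, ∀ᶠ a in l, M.energyNorm (f a) ≤ C * M.energyNorm (g a) ^ 2 := by
  obtain ⟨c, hc, hlow⟩ := M.exists_le_energyNorm
  obtain ⟨C, hC, hup⟩ := M.exists_energyNorm_le
  obtain ⟨K, hK, hbound⟩ := h.exists_pos
  refine ⟨C * K / c ^ 2, by positivity, hbound.bound.mono fun a ha => ?_⟩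
  rw [Real.norm_of_nonneg (by positivity)] at ha
  calc M.energyNorm (f a) ≤ C * ‖f a‖ := hup _
    _ ≤ C * (K * ‖g a‖ ^ 2) := by gcongr
    _ = C * K / c ^ 2 * (c * ‖g a‖) ^ 2 := by field_simp
    _ ≤ C * K / c ^ 2 * M.energyNorm (g a) ^ 2 := by gcongr; exact hlow _

theorem eventually_forall_of_energyNorm_eq_one {q : V → Prop} (h : ∀ᶠ x in 𝓝 0, q x) :
    ∀ᶠ δ in 𝓝[>] (0 : ℝ), ∀ x, M.energyNorm x = 1 → q (δ • x) := by
  obtain ⟨c, hc, hlow⟩ := M.exists_le_energyNorm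
  obtain ⟨r, hr, hq⟩ := Metric.eventually_nhds_iff_ball.1 h
  filter_upwards [Ioo_mem_nhdsGT (mul_pos hc hr)] with δ ⟨hδ0, hδ⟩ x hx
  refine hq _ (mem_ball_zero_iff.2 (lt_of_mul_lt_mul_left ?_ hc.le))
  calc c * ‖δ • x‖ ≤ M.energyNorm (δ • x) := hlow _
    _ = δ := by rw [map_smul_eq_mul, hx, Real.norm_of_nonneg hδ0.le, mul_one]
    _ < c * r := hδ

end AccelerationOperator

namespace PCSOM

variable {V H : Type*} [NormedAddCommGroup V] [NormedSpace ℝ V]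
  [NormedAddCommGroup H] [InnerProductSpace ℝ H] {ι : V →L[ℝ] H} (M : AccelerationOperator V)
  {L00 : V → StrongDual ℝ V} {μ : ℝ} {u : V} {Δt : ℝ}

theorem tendsto_normalize (hu : power ι u ≠ 0) :
    Tendsto (normalize ι (power ι u)) (𝓝 u) (𝓝 u) := by
  simpa only [ContinuousAt, normalize_power hu] using (hasFDerivAt_normalize ι hu).continuousAt

theorem power_add_of_embed_eq_zero {x : V} (hx : embed ι u x = 0) :
    power ι (u + x) = power ι u + power ι x := by
  have hx' : embed ι x u = 0 := (ip_comm ι x u).trans hx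
  simp [power, ← embed_apply, hx, hx']

theorem power_normalize_add (hu : power ι u ≠ 0) {x : V} (hx : embed ι u x = 0) :
    power ι (normalize ι (power ι u) (u + x)) = power ι u := by
  refine power_normalize ι (power_nonneg ι u) ?_
  rw [power_add_of_embed_eq_zero hx]
  exact (add_pos_of_pos_of_nonneg ((power_nonneg ι u).lt_of_ne' hu) (power_nonneg ι x)).ne'

/-- Hence `x ↦ normalize ι (power ι u) (u + x)` parametrizes the elements of the power of `u` by
their component in `S`, up to quadratic terms. -/
theorem isBigO_orthProj_normalize_add_sub (hu : power ι u ≠ 0) :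
    (fun x => orthProj ι M u (normalize ι (power ι u) (u + x) - u) - x)
      =O[𝓝[{x | embed ι u x = 0}] 0] fun x => ‖x‖ ^ 2 := by
  have hlim : Tendsto (fun x => u + x) (𝓝[{x | embed ι u x = 0}] 0) (𝓝 u) := by
    have : Continuous fun x => u + x := by fun_prop
    simpa using (this.tendsto 0).mono_left nhdsWithin_le_nhds
  have hO := (hasLipFDerivAt_normalize ι hu).isBigO_sub_sq.comp_tendsto hlim
  refine (((orthProj ι M u).isBigO_comp _ _).trans hO).congr' ?_ (.of_forall fun x => by simp)
  filter_upwards [self_mem_nhdsWithin] with x hx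
  simp [normalize_power hu, radialProj_of_embed_eq_zero hx, orthProj_of_embed_eq_zero M hx]

theorem isBigO_sub_orthProj_sq :
    (fun v => v - u - orthProj ι M u (v - u)) =O[𝓝[{v | power ι v = power ι u}] u]
      fun v => ‖v - u‖ ^ 2 := by
  have hembed : (fun v => embed ι u (v - u)) =O[𝓝[{v | power ι v = power ι u}] u]
      fun v => ‖v - u‖ ^ 2 := by
    refine .of_bound ‖embed ι‖ ?_
    filter_upwards [self_mem_nhdsWithin] with v hv
    calc ‖embed ι u (v - u)‖ ≤ ‖2 * embed ι u (v - u)‖ := by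
          rw [norm_mul, Real.norm_two]
          linarith [norm_nonneg (embed ι u (v - u))]
      _ = ‖embed ι (v - u) (v - u)‖ := by
          rw [two_mul_embed_sub u hv, sub_self, add_zero, ← neg_sub, map_neg, _root_.neg_apply,
            norm_neg]
      _ ≤ ‖embed ι‖ * ‖v - u‖ * ‖v - u‖ := (embed ι).le_opNorm₂ _ _
      _ = ‖embed ι‖ * ‖‖v - u‖ ^ 2‖ := by
          rw [norm_pow, norm_norm]
          ring
  refine ((ContinuousLinearMap.toSpanSingleton ℝ
    ((denom ι M u)⁻¹ • Minv M (embed ι u))).isBigO_comp _ _).trans hembed |>.congr_left fun v => ?_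
  rw [orthProj_apply, sub_sub_cancel, ContinuousLinearMap.toSpanSingleton_apply, smul_smul,
    mul_comm]

theorem isBigO_sub_orthProj :
    (fun v => v - u) =O[𝓝[{v | power ι v = power ι u}] u] fun v => orthProj ι M u (v - u) := by
  have hlim : Tendsto (fun v => (v, u)) (𝓝[{v | power ι v = power ι u}] u) (𝓝 (u, u)) :=
    (tendsto_id.prodMk_nhds tendsto_const_nhds).mono_left nhdsWithin_le_nhds
  have hproj := Asymptotics.isLittleO_map.1
    (isLittleO_sub_orthProj M hlim (eventually_map.2 self_mem_nhdsWithin))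
  exact (hproj.isBigO.add (Asymptotics.isBigO_refl _ _)).congr_left fun v => sub_add_cancel _ _

theorem isBigO_orthProj_map_sub {F : V → V}
    (hF : HasLipFDerivAt F (stepDeriv ι M L00 μ u Δt) u) (hFu : F u = u) :
    (fun v => orthProj ι M u (F v - u) - stepDeriv ι M L00 μ u Δt (orthProj ι M u (v - u)))
      =O[𝓝[{v | power ι v = power ι u}] u] fun v => ‖orthProj ι M u (v - u)‖ ^ 2 := by
  set Q := orthProj ι M u
  set T := stepDeriv ι M L00 μ u Δt
  have hQT (x : V) : Q (T (Q x)) = T (Q x) := by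
    have hQ : embed ι u (Q x) = 0 := embed_orthProj ι M u x
    refine orthProj_of_embed_eq_zero M ?_
    rw [stepDeriv_of_embed_eq_zero M Δt hQ, map_add, hQ, map_smul, embed_LPCfull, smul_zero,
      add_zero]
  have hF' : (fun v => F v - u - T (v - u)) =O[𝓝[{v | power ι v = power ι u}] u]
      fun v => ‖v - u‖ ^ 2 := by
    simpa [hFu] using hF.isBigO_sub_sq.mono nhdsWithin_le_nhds
  have hT := (T.isBigO_comp _ _).trans (isBigO_sub_orthProj_sq (ι := ι) (u := u) M)
  refine (((Q.isBigO_comp _ _).trans (hF'.add hT)).trans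
    ((isBigO_sub_orthProj M).norm_norm.pow 2)).congr_left fun v => ?_
  rw [map_sub T (v - u), sub_add_sub_cancel, map_sub Q (F v - u), hQT]

theorem energyNorm_add_smul_LPCfull_le {lam : ℝ}
    (hlam : IsLeast (spectrum ℝ (LPC ι M L00 μ u)) lam) (hΔ0 : 0 ≤ Δt) (hΔ : 2 + Δt * lam ≤ 0)
    {x : V} (hx : embed ι u x = 0) :
    M.energyNorm (x + Δt • LPCfull ι M L00 μ u x) ≤ -(1 + Δt * lam) * M.energyNorm x := by
  have hquad := op_add_smul_LPCfull_le M hlam hx Δt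
  have hR : M.op (residualDeriv ι M L00 μ u x) (residualDeriv ι M L00 μ u x) ≤
      -lam * M.op x x := by
    linarith [op_LPCfull M (L00 := L00) (μ := μ) x hx, mul_op_self_le_op_LPCfull M hlam hx]
  have hmul := mul_le_mul_of_nonneg_left hR (mul_nonneg hΔ0 (neg_nonneg.2 hΔ))
  refine le_of_sq_le_sq ?_ (mul_nonneg (by linarith) (apply_nonneg _ _))
  rw [mul_pow, M.energyNorm_sq, M.energyNorm_sq]
  linarith

theorem exists_energyNorm_add_smul_LPCfull_le {lam : ℝ}
    (hlam : lam ∈ spectrum ℝ (LPC ι M L00 μ u)) (Δt : ℝ) {η : ℝ} (hη : 0 < η) :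
    ∃ x, embed ι u x = 0 ∧ M.energyNorm x = 1 ∧
      M.energyNorm (x + Δt • LPCfull ι M L00 μ u x + -(1 + Δt * lam) • x) ≤ η := by
  obtain ⟨c, hc, hlow⟩ := M.exists_le_energyNorm
  obtain ⟨C, hC, hup⟩ := M.exists_energyNorm_le
  obtain ⟨x, hx0, hxS, hx⟩ := exists_norm_LPCfull_sub_smul_le M hlam
    (η := c / (C * (|Δt| + 1)) * η) (by positivity)
  set G := LPCfull ι M L00 μ u
  have hpos : 0 < M.energyNorm x := (mul_pos hc (norm_pos_iff.2 hx0)).trans_le (hlow x)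
  have hdefect : M.energyNorm (Δt • (G x - lam • x)) ≤ η * M.energyNorm x := by
    calc M.energyNorm (Δt • (G x - lam • x)) = |Δt| * M.energyNorm (G x - lam • x) :=
          map_smul_eq_mul _ _ _
      _ ≤ (|Δt| + 1) * (C * (c / (C * (|Δt| + 1)) * η * ‖x‖)) := by
          gcongr
          · linarith
          · exact (hup _).trans (by gcongr)
      _ = η * (c * ‖x‖) := by field_simp
      _ ≤ η * M.energyNorm x := by gcongr; exact hlow x
  have hscale (a : ℝ) : a • x + Δt • G (a • x) + -(1 + Δt * lam) • a • x =
      a • Δt • (G x - lam • x) := by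
    rw [map_smul]
    module
  refine ⟨(M.energyNorm x)⁻¹ • x, by rw [map_smul, hxS, smul_zero], ?_, ?_⟩
  · rw [map_smul_eq_mul, norm_inv, Real.norm_of_nonneg hpos.le, inv_mul_cancel₀ hpos.ne']
  · rwa [hscale, map_smul_eq_mul, norm_inv, Real.norm_of_nonneg hpos.le, inv_mul_le_iff₀ hpos,
      mul_comm]

theorem power_iterates {ε : ℝ}
    (hstep : ∀ v, ‖v - u‖ < ε → power ι (step ι M L00 (power ι u) Δt v) = power ι u) {v : V}
    (hv : power ι v = power ι u) (hstay : ∀ n, ‖iterates ι M L00 (power ι u) Δt v n - u‖ < ε)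
    (n : ℕ) : power ι (iterates ι M L00 (power ι u) Δt v n) = power ι u := by
  cases n with
  | zero => exact hv
  | succ n =>
    rw [iterates, Function.iterate_succ_apply']
    exact hstep _ (hstay n)

theorem exists_eventually_exists_le_energyNorm {lam : ℝ}
    (hlam : IsLeast (spectrum ℝ (LPC ι M L00 μ u)) lam) (hΔ0 : 0 ≤ Δt) (hΔ : 2 + Δt * lam < 0)
    {C : ℝ} (hC : 0 ≤ C) :
    ∃ ρ > 0, ∀ᶠ δ in 𝓝[>] (0 : ℝ), ∃ x, embed ι u x = 0 ∧ M.energyNorm x = 1 ∧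
      ∀ z : ℕ → V, (∀ k, embed ι u (z k) = 0) → M.energyNorm (z 0 - δ • x) ≤ C * δ ^ 2 →
        (∀ k, M.energyNorm (z (k + 1) - stepDeriv ι M L00 μ u Δt (z k)) ≤
          C * M.energyNorm (z k) ^ 2) →
        ∃ N, ρ ≤ M.energyNorm (z N) := by
  refine exists_eventually_exists_le_seminorm (S := orthSpace ι u)
    (T := (stepDeriv ι M L00 μ u Δt : V →ₗ[ℝ] V)) (r := -(1 + Δt * lam)) (by linarith) hC
    (fun x hx => ?_) fun η hη => ?_
  · exact (stepDeriv_of_embed_eq_zero M Δt hx).symm ▸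
      energyNorm_add_smul_LPCfull_le M hlam hΔ0 hΔ.le hx
  · obtain ⟨x, hxS, hx, hxη⟩ := exists_energyNorm_add_smul_LPCfull_le M hlam.1 Δt hη
    exact ⟨x, hxS, hx, (stepDeriv_of_embed_eq_zero M Δt hxS).symm ▸ hxη⟩

variable (hu : power ι u ≠ 0)
include hu

theorem exists_eventually_normalize_add :
    ∃ C > 0, ∀ δ' > 0, ∀ᶠ x in 𝓝 0, embed ι u x = 0 →
      ‖normalize ι (power ι u) (u + x) - u‖ < δ' ∧
      power ι (normalize ι (power ι u) (u + x)) = power ι u ∧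
      M.energyNorm (orthProj ι M u (normalize ι (power ι u) (u + x) - u) - x) ≤
        C * M.energyNorm x ^ 2 := by
  obtain ⟨C, hC, hquad⟩ := M.exists_eventually_energyNorm_le_mul_sq
    (isBigO_orthProj_normalize_add_sub M hu)
  refine ⟨C, hC, fun δ' hδ' => ?_⟩
  have hlim : Tendsto (fun x => normalize ι (power ι u) (u + x)) (𝓝 0) (𝓝 u) :=
    (tendsto_normalize hu).comp (Continuous.tendsto' (by fun_prop) _ _ (add_zero u))
  filter_upwards [eventually_nhdsWithin_iff.1 hquad, hlim (Metric.ball_mem_nhds u hδ')]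
    with x hx hball hxS
  exact ⟨mem_ball_iff_norm.1 hball, power_normalize_add hu hxS, hx hxS⟩

variable (h : L0 ι L00 μ u = 0) (hL : HasLipFDerivAt L00 (fderiv ℝ L00 u) u)
  (hX : LipschitzNear (fderiv ℝ L00) u)
include h hL hX

theorem divergesFrom {lam : ℝ} (hlam : IsLeast (spectrum ℝ (LPC ι M L00 μ u)) lam) (hΔ0 : 0 ≤ Δt)
    (hΔ : 2 + Δt * lam < 0) : DivergesFrom ι M L00 u (power ι u) Δt := by
  obtain ⟨C₁, hC₁, hrec⟩ := M.exists_eventually_energyNorm_le_mul_sq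
    (isBigO_orthProj_map_sub M (hasLipFDerivAt_step M Δt hu h hL hX) (step_eq_self M Δt hu h))
  obtain ⟨C₂, -, hinit⟩ := exists_eventually_normalize_add M hu
  obtain ⟨ρ, hρ, hgrow⟩ := exists_eventually_exists_le_energyNorm M hlam hΔ0 hΔ
    (le_max_of_le_left hC₁.le : 0 ≤ max C₁ C₂)
  have hsmall : ∀ᶠ v in 𝓝 u, M.energyNorm (orthProj ι M u (v - u)) < ρ := by
    have hcont : Continuous fun v => M.energyNorm (orthProj ι M u (v - u)) :=
      M.continuous_energyNorm.comp (by fun_prop)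
    exact hcont.continuousAt.eventually_lt continuousAt_const (by simpa using hρ)
  obtain ⟨ε, hε, hball⟩ := Metric.eventually_nhds_iff_ball.1
    ((eventually_nhdsWithin_iff.1 hrec).and ((eventually_power_step M Δt hu h hL hX).and hsmall))
  refine ⟨ε, hε, fun δ' hδ' => ?_⟩
  obtain ⟨δ, ⟨x, hxS, hx, hesc⟩, hδ, hδ0⟩ := (hgrow.and
    ((M.eventually_forall_of_energyNorm_eq_one (hinit δ' hδ')).and self_mem_nhdsWithin)).exists
  obtain ⟨hclose, hpow, hstart⟩ := hδ x hx (by rw [map_smul, hxS, smul_zero])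
  set v := normalize ι (power ι u) (u + δ • x)
  refine ⟨v, hclose, hpow, ?_⟩
  by_contra! hstay
  have hnear (n : ℕ) := hball _ (mem_ball_iff_norm.2 (hstay n))
  have hpow' := power_iterates M (fun w hw => (hball w (mem_ball_iff_norm.2 hw)).2.1) hpow hstay
  obtain ⟨N, hN⟩ : ∃ N, ρ ≤ M.energyNorm (orthProj ι M u
      (iterates ι M L00 (power ι u) Δt v N - u)) := by
    refine hesc _ (fun n => embed_orthProj ι M u _) ?_ fun n => ?_
    · rw [map_smul_eq_mul, hx, mul_one, Real.norm_of_nonneg (le_of_lt hδ0)] at hstart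
      exact hstart.trans (by gcongr; exact le_max_right _ _)
    · rw [iterates, Function.iterate_succ_apply']
      exact ((hnear n).1 (hpow' n)).trans (by gcongr; exact le_max_left _ _)
  exact (hnear N).2.2.not_ge hN

end PCSOM

/-! ### Generic divergence -/

namespace PCSOM

variable {V H : Type*} [NormedAddCommGroup V] [NormedSpace ℝ V]
  [NormedAddCommGroup H] [InnerProductSpace ℝ H] {ι : V →L[ℝ] H} (M : AccelerationOperator V)
  {L00 : V → StrongDual ℝ V} {μ : ℝ} {u : V} {Δt : ℝ}

section GapForm

variable (ι L00) in
/-- The form `⟨(ν - 𝓛_PC) x, y⟩` with respect to `M`. For `ν` in a gap of the spectrum it is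
positive in some directions and is expanded by the iteration. -/
noncomputable def gapForm (μ : ℝ) (u : V) (ν : ℝ) : V →L[ℝ] StrongDual ℝ V :=
  (M.op : V →L[ℝ] StrongDual ℝ V) ∘L (ν • ContinuousLinearMap.id ℝ V - LPCfull ι M L00 μ u)

theorem gapForm_apply (ν : ℝ) (x y : V) : gapForm ι M L00 μ u ν x y =
    ν * M.op x y - M.op (LPCfull ι M L00 μ u x) y := by
  simp [gapForm]

theorem exists_gapForm_pos {lam ν : ℝ} (hlam : lam ∈ spectrum ℝ (LPC ι M L00 μ u)) (hν : lam < ν) :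
    ∃ x, embed ι u x = 0 ∧ 0 < gapForm ι M L00 μ u ν x x := by
  obtain ⟨c, hc, hcoer⟩ := M.isCoercive
  set m := ‖(M.op : V →L[ℝ] StrongDual ℝ V)‖
  have hm : 0 < m + 1 := by positivity
  have hgap : 0 < ν - lam := by linarith
  obtain ⟨x, hx0, hxS, hx⟩ := exists_norm_LPCfull_sub_smul_le M hlam
    (η := c * (ν - lam) / (2 * (m + 1))) (by positivity)
  refine ⟨x, hxS, ?_⟩
  set e := LPCfull ι M L00 μ u x - lam • x with he
  have herr : M.op e x ≤ c * (ν - lam) / 2 * (‖x‖ * ‖x‖) :=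
    calc M.op e x ≤ m * ‖e‖ * ‖x‖ :=
          (le_abs_self _).trans ((M.op : V →L[ℝ] StrongDual ℝ V).le_opNorm₂ e x)
      _ ≤ (m + 1) * (c * (ν - lam) / (2 * (m + 1)) * ‖x‖) * ‖x‖ := by
        gcongr
        linarith
      _ = c * (ν - lam) / 2 * (‖x‖ * ‖x‖) := by field_simp
  have hform : gapForm ι M L00 μ u ν x x = (ν - lam) * M.op x x - M.op e x := by
    simp only [gapForm_apply, he, map_sub, map_smul, _root_.sub_apply, _root_.smul_apply,
      smul_eq_mul]
    ring
  have hpos : 0 < c * (ν - lam) / 2 * (‖x‖ * ‖x‖) := by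
    have := norm_pos_iff.2 hx0
    positivity
  have hlow : c * ‖x‖ * ‖x‖ ≤ M.op x x := hcoer x
  linarith [mul_le_mul_of_nonneg_left hlow hgap.le]

theorem gapForm_add_smul_LPCfull (ν : ℝ) {x g : V} (hx : embed ι u x = 0)
    (hg : LPCfull ι M L00 μ u x - ν • x = g) :
    gapForm ι M L00 μ u ν (x + Δt • LPCfull ι M L00 μ u x) (x + Δt • LPCfull ι M L00 μ u x) =
      (1 + Δt * ν) ^ 2 * gapForm ι M L00 μ u ν x x - Δt * (2 + Δt * ν) * M.op g g
        - Δt ^ 2 * M.op (LPCfull ι M L00 μ u g) g := by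
  have hgS : embed ι u g = 0 := by simp [← hg, hx, embed_LPCfull]
  have hLx : LPCfull ι M L00 μ u x = g + ν • x := by simp [← hg]
  have hLg : M.op (LPCfull ι M L00 μ u g) x = M.op g g + ν * M.op g x := by
    rw [op_LPCfull M g hx, M.hermitian, ← op_LPCfull M x hgS, hLx]
    simp [M.hermitian x g]
  have hstep : x + Δt • LPCfull ι M L00 μ u x = (1 + Δt * ν) • x + Δt • g := by
    rw [hLx]
    module
  rw [hstep]
  simp only [gapForm_apply, map_add, map_smul, _root_.add_apply, _root_.smul_apply, smul_eq_mul,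
    hLx, hLg, M.hermitian x g]
  ring

theorem exists_gapForm_add_smul_LPCfull_ge (hΔ0 : 0 < Δt) {ν : ℝ}
    (hν : ν ∉ spectrum ℝ (LPC ι M L00 μ u)) (hΔ : 2 + Δt * ν < 0) :
    ∃ κ > 0, ∀ x, embed ι u x = 0 →
      (1 + Δt * ν) ^ 2 * gapForm ι M L00 μ u ν x x + κ * ‖x‖ ^ 2 ≤
        gapForm ι M L00 μ u ν (x + Δt • LPCfull ι M L00 μ u x)
          (x + Δt • LPCfull ι M L00 μ u x) := by
  obtain ⟨c, hc, hcoer⟩ := M.isCoercive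
  obtain ⟨d, hd, hgap⟩ := exists_mul_norm_le_LPCfull_sub_smul M hν
  have hcoef : 0 < -(Δt * (2 + Δt * ν)) := neg_pos.2 (mul_neg_of_pos_of_neg hΔ0 hΔ)
  refine ⟨-(Δt * (2 + Δt * ν)) * (c * d ^ 2), by positivity, fun x hx => ?_⟩
  set g := LPCfull ι M L00 μ u x - ν • x with hg
  have hgS : embed ι u g = 0 := by simp [hg, hx, embed_LPCfull]
  have hlow : c * d ^ 2 * ‖x‖ ^ 2 ≤ M.op g g :=
    calc c * d ^ 2 * ‖x‖ ^ 2 = c * (d * ‖x‖) * (d * ‖x‖) := by ring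
      _ ≤ c * ‖g‖ * ‖g‖ := by gcongr <;> exact hgap x hx
      _ ≤ M.op g g := hcoer g
  rw [gapForm_add_smul_LPCfull M ν hx hg.symm]
  linarith [mul_le_mul_of_nonneg_left hlow hcoef.le,
    mul_nonpos_of_nonneg_of_nonpos (sq_nonneg Δt) (op_LPCfull_self_nonpos M (μ := μ)
      (L00 := L00) hgS)]

theorem eventually_gapForm_map_sub_ge {l : Filter (V × V)} (hl : l ≤ 𝓝 (u, u))
    (hpow : ∀ᶠ p in l, power ι p.1 = power ι p.2) {F : V → V}
    (hF : HasStrictFDerivAt F (stepDeriv ι M L00 μ u Δt) u) (hΔ0 : 0 < Δt) {ν : ℝ}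
    (hν : ν ∉ spectrum ℝ (LPC ι M L00 μ u)) (hΔ : 2 + Δt * ν < 0) :
    ∀ᶠ p in l, (1 + Δt * ν) ^ 2 * gapForm ι M L00 μ u ν (p.1 - p.2) (p.1 - p.2) ≤
      gapForm ι M L00 μ u ν (F p.1 - F p.2) (F p.1 - F p.2) := by
  obtain ⟨κ, hκ, hstep⟩ := exists_gapForm_add_smul_LPCfull_ge M hΔ0 hν hΔ
  have hbefore := isLittleO_apply_self_sub (gapForm ι M L00 μ u ν)
    (isLittleO_sub_orthProj M hl hpow) (Asymptotics.isBigO_refl _ l)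
  have hafter := isLittleO_apply_self_sub (gapForm ι M L00 μ u ν)
    (isLittleO_map_sub M hl hpow hF) ((stepDeriv ι M L00 μ u Δt).isBigO_comp _ _)
  filter_upwards [(hafter.sub (hbefore.const_mul_left ((1 + Δt * ν) ^ 2))).bound hκ] with p hp
  rw [Real.norm_of_nonneg (sq_nonneg _)] at hp
  have hlin := hstep (orthProj ι M u (p.1 - p.2)) (embed_orthProj ι M u _)
  rw [← stepDeriv_of_embed_eq_zero M Δt (embed_orthProj ι M u _)] at hlin
  linarith [(abs_le.1 hp).1]

end GapForm

theorem eventually_exists_perturbation_pos (hu : power ι u ≠ 0) (b : V →L[ℝ] StrongDual ℝ V) {x : V}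
    (hx : embed ι u x = 0) (hb : 0 < b x x) :
    ∀ᶠ v in 𝓝 u, power ι v = power ι u → ∀ δ > 0, ∃ w, ‖w - v‖ < δ ∧
      power ι w = power ι u ∧ 0 < b (w - v) (w - v) := by
  have hpower : Continuous (power ι) := (contDiff_power (n := 0) ι).continuous
  have hform : ContinuousAt (fun v => b (radialProj ι v x) (radialProj ι v x)) u := by
    have hproj : ContinuousAt (fun v => radialProj ι v x) u := by
      simp only [radialProj, _root_.sub_apply, _root_.smul_apply,
        ContinuousLinearMap.smulRight_apply, ContinuousLinearMap.id_apply]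
      have : ContinuousAt (fun v => (power ι v)⁻¹) u := hpower.continuousAt.inv₀ hu
      fun_prop
    exact (show Continuous fun y => b y y by fun_prop).continuousAt.comp hproj
  have hpos := hform.eventually_const_lt (u := 0) (by simpa only [radialProj_of_embed_eq_zero hx])
  filter_upwards [hpos] with v hv hvu δ hδ
  have hv0 : power ι v ≠ 0 := hvu ▸ hu
  have hline : Tendsto (fun t : ℝ => v + t • x) (𝓝[≠] 0) (𝓝 v) :=
    (Continuous.tendsto' (by fun_prop) _ _ (by simp)).mono_left nhdsWithin_le_nhds
  have hnear : Tendsto (fun t : ℝ => normalize ι (power ι v) (v + t • x)) (𝓝[≠] 0) (𝓝 v) :=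
    (tendsto_normalize hv0).comp hline
  obtain ⟨t, htb, htδ, htp⟩ := ((eventually_apply_sub_self_pos b
    (hasFDerivAt_normalize ι hv0) hv).and ((hnear.eventually (Metric.ball_mem_nhds v hδ)).and
      (hline.eventually (hpower.continuousAt.eventually_ne hv0)))).exists
  refine ⟨normalize ι (power ι v) (v + t • x), mem_ball_iff_norm.1 htδ, ?_, ?_⟩
  · rw [power_normalize ι (power_nonneg ι v) htp, hvu]
  · rwa [normalize_power hv0] at htb

theorem divergesGenerically (hu : power ι u ≠ 0) (h : L0 ι L00 μ u = 0)
    (hL : HasLipFDerivAt L00 (fderiv ℝ L00 u) u) (hX : LipschitzNear (fderiv ℝ L00) u)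
    {lam ν : ℝ} (hlam : lam ∈ spectrum ℝ (LPC ι M L00 μ u)) (hΔ0 : 0 < Δt)
    (hν : ν ∉ spectrum ℝ (LPC ι M L00 μ u)) (hlν : lam < ν) (hΔ : 2 + Δt * ν < 0) :
    DivergesGenerically ι M L00 u (power ι u) Δt := by
  set b := gapForm ι M L00 μ u ν
  obtain ⟨x, hxS, hx⟩ := exists_gapForm_pos M hlam hlν
  have hexp : ∀ᶠ p in 𝓝 u ×ˢ 𝓝 u, power ι p.1 = power ι p.2 →
      (1 + Δt * ν) ^ 2 * b (p.1 - p.2) (p.1 - p.2) ≤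
        b (step ι M L00 (power ι u) Δt p.1 - step ι M L00 (power ι u) Δt p.2)
          (step ι M L00 (power ι u) Δt p.1 - step ι M L00 (power ι u) Δt p.2) :=
    eventually_inf_principal.1 (eventually_gapForm_map_sub_ge M
      (inf_le_left.trans nhds_prod_eq.ge) (eventually_inf_principal.2 (.of_forall fun _ => id))
      (hasLipFDerivAt_step M Δt hu h hL hX).hasStrictFDerivAt hΔ0 hν hΔ)
  obtain ⟨W, hW, hexpW⟩ := eventually_prod_self_iff'.1 hexp
  obtain ⟨ε, hε, hball⟩ := Metric.eventually_nhds_iff_ball.1 ((eventually_power_step M Δt hu h hL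
    hX).and ((eventually_exists_perturbation_pos hu b hxS hx).and hW))
  refine ⟨ε, hε, fun v hv hvP δ hδ => ?_⟩
  by_cases! hesc : ∃ n, ε ≤ ‖iterates ι M L00 (power ι u) Δt v n - u‖
  · exact ⟨v, by simpa using hδ, hvP, hesc⟩
  obtain ⟨w, hwv, hwP, hpos⟩ := (hball v (mem_ball_iff_norm.2 hv)).2.1 hvP δ hδ
  refine ⟨w, hwv, hwP, ?_⟩
  by_contra! hstay
  have hpow := fun y hy => (hball y (mem_ball_iff_norm.2 hy)).1
  have hτ : 1 < (1 + Δt * ν) ^ 2 := by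
    rw [one_lt_sq_iff_one_lt_abs, lt_abs]
    exact .inr (by linarith)
  obtain ⟨n, hn⟩ : ∃ n, ε + ε < ‖iterates ι M L00 (power ι u) Δt w n -
      iterates ι M L00 (power ι u) Δt v n‖ := by
    refine exists_lt_norm_of_expanding b hτ hpos (fun n => ?_) _
    have hmem (y : V) (hy : ‖y - u‖ < ε) := (hball y (mem_ball_iff_norm.2 hy)).2.2
    simp only [iterates, Function.iterate_succ_apply']
    exact hexpW _ (hmem _ (hstay n)) _ (hmem _ (hesc n))
      ((power_iterates M hpow hwP hstay n).trans (power_iterates M hpow hvP hesc n).symm)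
  refine hn.not_ge ?_
  rw [← sub_sub_sub_cancel_right _ _ u]
  exact (norm_sub_le _ _).trans (add_le_add (hstay n).le (hesc n).le)

end PCSOM

theorem exists_notMem_spectrum_of_not_Icc_subset {X : Type*} [NormedAddCommGroup X]
    [NormedSpace ℝ X] [CompleteSpace X] {T : X →L[ℝ] X} {lam r : ℝ} (hlam : lam ∈ spectrum ℝ T)
    (h : ¬Set.Icc lam r ⊆ spectrum ℝ T) : ∃ ν ∉ spectrum ℝ T, lam < ν ∧ ν < r := by
  obtain ⟨ν, ⟨hlamν, hνr⟩, hν⟩ := Set.not_subset.1 h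
  have hlt : lam < ν := hlamν.lt_of_ne fun heq => hν (heq ▸ hlam)
  have hopen : ∀ᶠ t in 𝓝[<] ν, t ∉ spectrum ℝ T :=
    mem_nhdsWithin_of_mem_nhds ((spectrum.isClosed T).isOpen_compl.mem_nhds hν)
  obtain ⟨t, ht, hlamt, htν⟩ := (hopen.and (Ioo_mem_nhdsLT hlt)).exists
  exact ⟨t, ht, hlamt, htν.trans_le hνr⟩

theorem theorem3_general
    {V H : Type*} [NormedAddCommGroup V] [NormedSpace ℝ V]
    [NormedAddCommGroup H] [InnerProductSpace ℝ H] (ι : V →L[ℝ] H)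
    (M : AccelerationOperator V) (L00 : V → StrongDual ℝ V)
    {s : ℕ} (U : ℝ → (Fin s → ℝ) → V) (μ : ℝ) (c₀ : Fin s → ℝ)
    (u : V) (hu : u = U μ c₀) (hU : PCSOM.IsSolutionFamily ι L00 U μ c₀)
    (hdiff : ∀ᶠ v in 𝓝 u, DifferentiableAt ℝ L00 v)
    (hLip : ∃ K, ∃ W ∈ 𝓝 u, LipschitzOnWith K (fderiv ℝ L00) W)
    (hker : LinearMap.ker (PCSOM.L1 ι L00 μ u : V →ₗ[ℝ] StrongDual ℝ V) =
      Submodule.span ℝ (Set.range (PCSOM.invarianceMode U μ c₀)))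
    (horth : ∀ Ψ : V, PCSOM.L1 ι L00 μ u Ψ = 0 → PCSOM.ip ι u Ψ = 0)
    (P : ℝ) (hP : P = PCSOM.power ι u)
    (hP' : deriv (fun m => PCSOM.power ι (U m c₀)) μ ≠ 0)
    (Λmin : ℝ) (hΛ : IsLeast (spectrum ℝ (PCSOM.LPC ι M L00 μ u)) Λmin) (hΛ0 : Λmin ≠ 0) :
    (IsClosed (Set.range (PCSOM.L1 ι L00 μ u)) →
      ∀ Δt : ℝ, 0 < Δt → Δt < -2 / Λmin → PCSOM.ConvergesNear ι M L00 U μ c₀ P Δt) ∧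
    (∀ Δt : ℝ, -2 / Λmin < Δt → PCSOM.DivergesFrom ι M L00 u P Δt ∧
      (¬ Set.Icc Λmin (-2 / Δt) ⊆ spectrum ℝ (PCSOM.LPC ι M L00 μ u) →
        PCSOM.DivergesGenerically ι M L00 u P Δt)) := by
  subst hu hP
  obtain ⟨K, W, hW, hLipW⟩ := hLip
  have hX := LipschitzNear.of_lipschitzOnWith hW hLipW
  have hL := HasLipFDerivAt.of_lipschitzNear_fderiv hdiff hX
  have hsol := hU.2.self_of_nhds
  have hpow := PCSOM.power_ne_zero_of_deriv_power_ne_zero hP'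
  have hΛneg := (PCSOM.nonpos_of_isLeast_spectrum_LPC M hΛ).lt_of_ne hΛ0
  refine ⟨fun hclosed Δt hΔ0 hΔ => ?_, fun Δt hΔ => ?_⟩
  · rw [lt_div_iff_of_neg hΛneg] at hΔ
    exact PCSOM.convergesNear M hU hker horth hP' hL hX hΛ hclosed hΔ0 (by linarith)
  · have hΔ0 := (div_pos_of_neg_of_neg (by norm_num) hΛneg).trans hΔ
    rw [div_lt_iff_of_neg hΛneg] at hΔ
    refine ⟨PCSOM.divergesFrom M hpow hsol hL hX hΛ hΔ0.le (by linarith), fun hgap => ?_⟩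
    have := M.completeSpace
    have := (PCSOM.isClosed_orthSpace ι (U μ c₀)).completeSpace_coe
    obtain ⟨ν, hν, hΛν, hνr⟩ := exists_notMem_spectrum_of_not_Icc_subset hΛ.1 hgap
    rw [lt_div_iff₀ hΔ0] at hνr
    exact PCSOM.divergesGenerically M hpow hsol hL hX hΛ.1 hΔ0 hν hΛν (by linarith)

theorem theorem3
    {V H : Type*} [NormedAddCommGroup V] [NormedSpace ℝ V] [CompleteSpace V]
    [NormedAddCommGroup H] [InnerProductSpace ℝ H]
    -- the inclusion of the energy space `V` of `M` in `H`
    (ι : V →L[ℝ] H) (hι : Function.Injective ι)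
    (M : AccelerationOperator V) (L00 : V → StrongDual ℝ V)
    -- the solitary wave `u = u(x; μ, c₀)` and the family of solutions it belongs to
    {s : ℕ} (U : ℝ → (Fin s → ℝ) → V) (μ : ℝ) (c₀ : Fin s → ℝ)
    (u : V) (hu : u = U μ c₀) (hU : PCSOM.IsSolutionFamily ι L00 U μ c₀)
    -- near `u` the operator `L₀₀` has a Lipschitz continuous derivative
    (hdiff : ∀ᶠ v in 𝓝 u, DifferentiableAt ℝ L00 v)
    (hLip : ∃ K, ∃ W ∈ 𝓝 u, LipschitzOnWith K (fderiv ℝ L00) W)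
    -- the kernel of `L₁` consists of the invariance modes only
    (hker : LinearMap.ker (PCSOM.L1 ι L00 μ u : V →ₗ[ℝ] StrongDual ℝ V) =
      Submodule.span ℝ (Set.range (PCSOM.invarianceMode U μ c₀)))
    -- `u` is orthogonal to the kernel of `L₁`
    (horth : ∀ Ψ : V, PCSOM.L1 ι L00 μ u Ψ = 0 → PCSOM.ip ι u Ψ = 0)
    -- `P` is the power of `u`, and `P'(μ) ≠ 0`
    (P : ℝ) (hP : P = PCSOM.power ι u)
    (hP' : deriv (fun m => PCSOM.power ι (U m c₀)) μ ≠ 0)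
    -- `Λmin` is the minimum of the spectrum of `𝓛_PC` on `S`
    (Λmin : ℝ) (hΛ : IsLeast (spectrum ℝ (PCSOM.LPC ι M L00 μ u)) Λmin) (hΛ0 : Λmin ≠ 0) :
    -- convergence, zero not being in the continuous spectrum of `L₁`
    (IsClosed (Set.range (PCSOM.L1 ι L00 μ u)) →
      ∀ Δt : ℝ, 0 < Δt → Δt < -2 / Λmin → PCSOM.ConvergesNear ι M L00 U μ c₀ P Δt) ∧
    -- divergence, for generic initial conditions unless the spectrum is continuous
    -- all the way from `Λmin` to `-2 / Δt`
    (∀ Δt : ℝ, -2 / Λmin < Δt → PCSOM.DivergesFrom ι M L00 u P Δt ∧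
      (¬ Set.Icc Λmin (-2 / Δt) ⊆ spectrum ℝ (PCSOM.LPC ι M L00 μ u) →
        PCSOM.DivergesGenerically ι M L00 u P Δt)) :=
  theorem3_general ι M L00 U μ c₀ u hu hU hdiff hLip hker horth P hP hP' Λmin hΛ hΛ0
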